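/- Let $v_0:\mathbb R\to\mathbb C$ vanish for $t<0$, be smooth on $[0,\infty)$ (one-sided derivatives at $0$, so $v_0(0)\neq 0$ is allowed) and decay rapidly with all its derivatives as $t\to\infty$. Consider, for $\lambda=-\tfrac14$, the hyper-singular equation $$v(t)=v_0(t)+\int_0^t (t-s)^{\lambda-1}v(s)\,ds ,$$ read as $v=v_0+t_+^{-5/4}\star v$ in the sense of distributions on $[0,\infty)$, i.e. continuous linear functionals on the space $C_0^\infty([0,\infty))$ of compactly supported functions smooth up to $t=0$. Here $\langle f\star g,\varphi\rangle=\langle g_s,\langle f_t,\varphi(s+t)\rangle\rangle$, and $t_+^{\lambda-1}$ is defined by analytic continuation in $\lambda$, that is, $\langle t_+^{-5/4},\varphi\rangle=\int_0^\infty t^{-5/4}(\varphi(t)-\varphi(0))\,dt$ (which is $\int_0^\infty t^{-5/4}\varphi(t)\,dt$ if $\varphi\in C_0^\infty((0,\infty))$). Then: 1. The equation has a solution, and this solution is unique among all distributions on $[0,\infty)$. It is (given by) a continuous function $v$ on $\mathbb R$ that vanishes for $t<0$. 2. If the equation is tested only against $\varphi\in C_0^\infty((0,\infty))$, then $v$ is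 still the only solution among the distributions on $[0,\infty)$ given by locally integrable functions on $[0,\infty)$ that are $o(t^{-3/4})$ as $t\to0^+$. 3. The solution is less singular than $t^{-5/4}$: $v(t)=o(t^{-5/4})$ as $t\to0^+$. 4. For $\operatorname{Re}p>0$ the Laplace transform $L(v)(p)=\int_0^\infty e^{-pt}v(t)\,dt$ converges absolutely and, with the principal branch of $p^{1/4}$, $$L(v)(p)=\frac{L(v_0)(p)}{1+4\,\Gamma(3/4)\,p^{1/4}} .$$ 5. As $t\to0^+$, $\; t^{-1/4}v(t)\to \dfrac{v_0(0)}{4\,\Gamma(3/4)\,\Gamma(5/4)}$. So $v\sim \mathrm{const}\cdot t^{1/4}$ in the worst case $v_0(0)\ne0$. -/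

import Mathlib

open Set Filter Topology MeasureTheory
open scoped ContDiff

/-- Test functions on the closed half-line `[0, ∞)`.  An element of `C₀^∞([0, ∞))` (smooth up to
the end point `0`, with compact support in `[0, ∞)`) is represented by a smooth function on `ℝ`
which vanishes for all large `t`; the distributions below only see its values on `[0, ∞)`. -/
def halfLineTest : Submodule ℂ (ℝ → ℂ) where
  carrier := {φ | ContDiff ℝ ∞ φ ∧ ∃ b : ℝ, ∀ t, b ≤ t → φ t = 0}
  add_mem' := by
    rintro φ ψ ⟨h1, b, hb⟩ ⟨h2, c, hc⟩
    refine ⟨h1.add h2, max b c, fun t ht => ?_⟩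
    simp [hb t (le_trans (le_max_left _ _) ht), hc t (le_trans (le_max_right _ _) ht)]
  zero_mem' := ⟨contDiff_const, 0, fun _ _ => rfl⟩
  smul_mem' := by
    rintro a φ ⟨h1, b, hb⟩
    exact ⟨contDiff_const.smul h1, b, fun t ht => by simp [hb t ht]⟩

/-- A distribution on `[0, ∞)`: a linear functional on the test functions, which is continuous,
i.e. for each `b` it is bounded, on the test functions with support in `[0, b]`, by finitely many
of the seminorms `sup_{0 ≤ t ≤ b} |φ⁽ⁿ⁾(t)|`.  (In particular it depends on `φ|_{[0, ∞)}` only.) -/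
@[ext] structure HalfLineDistribution where
  /-- the underlying linear functional -/
  pair : halfLineTest →ₗ[ℂ] ℂ
  bound : ∀ b : ℝ, ∃ N : ℕ, ∃ C : ℝ, ∀ φ : halfLineTest, (∀ t, b ≤ t → φ.1 t = 0) →
    ∀ M : ℝ, 0 ≤ M → (∀ n ≤ N, ∀ t ∈ Icc 0 b, ‖iteratedDeriv n φ.1 t‖ ≤ M) → ‖pair φ‖ ≤ C * M

namespace HalfLineDistribution

/-- The translate `t ↦ φ (s + t)` of a test function. -/
def translate (s : ℝ) (φ : halfLineTest) : halfLineTest :=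
  ⟨fun t => φ.1 (s + t), φ.2.1.comp (contDiff_const.add contDiff_id), by
    obtain ⟨b, hb⟩ := φ.2.2
    exact ⟨b - s, fun t ht => hb _ (by linarith)⟩⟩

/-- The derivative of a test function. -/
noncomputable def testDeriv (φ : halfLineTest) : halfLineTest :=
  ⟨deriv φ.1, (contDiff_infty_iff_deriv.1 φ.2.1).2, by
    obtain ⟨b, hb⟩ := φ.2.2
    refine ⟨b + 1, fun t ht => ?_⟩
    have h : φ.1 =ᶠ[𝓝 t] fun _ => (0 : ℂ) := by
      filter_upwards [lt_mem_nhds (show b < t by linarith)] with x hx using hb x hx.le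
    rw [h.deriv_eq]; simp⟩

theorem contDiff_iteratedDeriv (φ : halfLineTest) (n : ℕ) : ContDiff ℝ ∞ (iteratedDeriv n φ.1) := by
  induction n with
  | zero => simpa using φ.2.1
  | succ n ih => rw [iteratedDeriv_succ]; exact (contDiff_infty_iff_deriv.1 ih).2

theorem exists_bound (φ : halfLineTest) (N : ℕ) (a b : ℝ) :
    ∃ M : ℝ, 0 ≤ M ∧ ∀ n ≤ N, ∀ t ∈ Icc a b, ‖iteratedDeriv n φ.1 t‖ ≤ M := by
  induction N with
  | zero =>
    obtain ⟨C, hC⟩ := (isCompact_Icc (a := a) (b := b)).exists_bound_of_continuousOn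
      (contDiff_iteratedDeriv φ 0).continuous.continuousOn
    refine ⟨max C 0, le_max_right _ _, fun n hn t ht => ?_⟩
    obtain rfl : n = 0 := by omega
    exact (hC t ht).trans (le_max_left _ _)
  | succ N ih =>
    obtain ⟨M, hM, h⟩ := ih
    obtain ⟨C, hC⟩ := (isCompact_Icc (a := a) (b := b)).exists_bound_of_continuousOn
      (contDiff_iteratedDeriv φ (N + 1)).continuous.continuousOn
    refine ⟨max C M, le_max_of_le_right hM, fun n hn t ht => ?_⟩
    rcases Nat.lt_or_ge N n with h1 | h1
    · obtain rfl : n = N + 1 := by omega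
      exact (hC t ht).trans (le_max_left _ _)
    · exact (h n h1 t ht).trans (le_max_right _ _)

theorem iteratedDeriv_vanish (φ : halfLineTest) (b : ℝ) (hb : ∀ t, b ≤ t → φ.1 t = 0) (n : ℕ)
    (t : ℝ) (ht : b ≤ t) : iteratedDeriv n φ.1 t = 0 := by
  have key : ∀ t, b < t → iteratedDeriv n φ.1 t = 0 := by
    intro t ht
    have h : φ.1 =ᶠ[𝓝 t] fun _ => (0 : ℂ) := by
      filter_upwards [lt_mem_nhds ht] with x hx using hb x hx.le
    rw [h.iteratedDeriv_eq]; simp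
  have hc : IsClosed {x | iteratedDeriv n φ.1 x = 0} :=
    isClosed_eq (contDiff_iteratedDeriv φ n).continuous continuous_const
  have : Ici b ⊆ {x | iteratedDeriv n φ.1 x = 0} := by
    rw [← closure_Ioi]; exact hc.closure_subset_iff.2 fun x hx => key x hx
  exact this ht

theorem second_order {F : ℝ → ℂ} (hF : ContDiff ℝ ∞ F) {x h M : ℝ}
    (hM : ∀ y, |y - x| ≤ |h| → ‖deriv (deriv F) y‖ ≤ M) :
    ‖F (x + h) - F x - h * deriv F x‖ ≤ M * |h| * |h| := by
  have hF' := (contDiff_infty_iff_deriv.1 hF).2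
  have d1 : Differentiable ℝ F := (contDiff_infty_iff_deriv.1 hF).1
  have d2 : Differentiable ℝ (deriv F) := (contDiff_infty_iff_deriv.1 hF').1
  have conv : Convex ℝ (Metric.closedBall x |h|) := convex_closedBall _ _
  have mx : x ∈ Metric.closedBall x |h| := by simp
  have mh : x + h ∈ Metric.closedBall x |h| := by simp
  have s1 : ∀ y ∈ Metric.closedBall x |h|, ‖deriv F y - deriv F x‖ ≤ M * |h| := by
    intro y hy
    have hy' : |y - x| ≤ |h| := by simpa [Real.dist_eq] using hy
    refine (conv.norm_image_sub_le_of_norm_deriv_le (fun z _ => d2 z)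
      (fun z hz => hM z (by simpa [Real.dist_eq] using hz)) mx hy).trans ?_
    have : 0 ≤ M := (norm_nonneg _).trans (hM x (by simp))
    rw [Real.norm_eq_abs]; gcongr
  have hG : ∀ y, HasDerivAt (fun y : ℝ => F y - y * deriv F x) (deriv F y - deriv F x) y := by
    intro y
    have h1 : HasDerivAt (fun y : ℝ => (y : ℂ) * deriv F x) (deriv F x) y := by
      simpa using (Complex.ofRealCLM.hasDerivAt (x := y)).mul_const (deriv F x)
    exact (d1 y).hasDerivAt.sub h1
  have s2 := conv.norm_image_sub_le_of_norm_hasDerivWithin_le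
    (fun y _ => (hG y).hasDerivWithinAt) s1 mx mh
  have e : F (x + h) - F x - h * deriv F x
      = (F (x + h) - (↑(x + h) : ℂ) * deriv F x) - (F x - (x : ℂ) * deriv F x) := by
    push_cast; ring
  rw [e]
  simpa using s2

theorem hasDerivAt_pair_translate (f : HalfLineDistribution) (φ : halfLineTest) (s : ℝ) :
    HasDerivAt (fun s => f.pair (translate s φ)) (f.pair (translate s (testDeriv φ))) s := by
  obtain ⟨b, hb⟩ := φ.2.2
  obtain ⟨N, C, hC⟩ := f.bound (b - s + 2)
  obtain ⟨M, hM0, hM⟩ := exists_bound φ (N + 2) (s - 1) (b + 3)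
  have main : ∀ h : ℝ, |h| ≤ 1 →
      ‖f.pair (translate (s + h) φ) - f.pair (translate s φ)
        - (h : ℂ) * f.pair (translate s (testDeriv φ))‖ ≤ C * M * |h| * |h| := by
    intro h hh
    have hh1 := abs_le.1 hh
    have e : f.pair (translate (s + h) φ) - f.pair (translate s φ)
        - (h : ℂ) * f.pair (translate s (testDeriv φ))
        = f.pair (translate (s + h) φ - translate s φ - (h : ℂ) • translate s (testDeriv φ)) := by
      simp [map_sub]
    rw [e]
    have := hC (translate (s + h) φ - translate s φ - (h : ℂ) • translate s (testDeriv φ)) ?_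
      (M * |h| * |h|) (by positivity) ?_
    · linarith
    · intro t ht
      have h1 : φ.1 (s + h + t) = 0 := hb _ (by linarith)
      have h2 : φ.1 (s + t) = 0 := hb _ (by linarith)
      have h3 : deriv φ.1 (s + t) = 0 := by
        have := iteratedDeriv_vanish φ b hb 1 (s + t) (by linarith)
        simpa using this
      simp [translate, testDeriv, h1, h2, h3]
    · intro n hn t ht
      have c1 : ContDiff ℝ ∞ (translate (s + h) φ).1 := (translate (s + h) φ).2.1
      have c2 : ContDiff ℝ ∞ (translate s φ).1 := (translate s φ).2.1
      have c3 : ContDiff ℝ ∞ (translate s (testDeriv φ)).1 := (translate s (testDeriv φ)).2.1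
      have le : ∀ {g : ℝ → ℂ}, ContDiff ℝ ∞ g → ContDiffAt ℝ n g t := fun hg =>
        (hg.of_le (by exact_mod_cast le_top)).contDiffAt
      have eq : iteratedDeriv n (translate (s + h) φ - translate s φ
          - (h : ℂ) • translate s (testDeriv φ)).1 t
          = iteratedDeriv n φ.1 ((s + t) + h) - iteratedDeriv n φ.1 (s + t)
            - h * deriv (iteratedDeriv n φ.1) (s + t) := by
        have h0 : (translate (s + h) φ - translate s φ - (h : ℂ) • translate s (testDeriv φ)).1
          = ((translate (s + h) φ).1 - (translate s φ).1) - (h : ℂ) • (translate s (testDeriv φ)).1 :=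
          rfl
        have c4 : ContDiff ℝ ∞ ((translate (s + h) φ).1 - (translate s φ).1) := c1.sub c2
        have c5 : ContDiff ℝ ∞ ((h : ℂ) • (translate s (testDeriv φ)).1) := contDiff_const.smul c3
        rw [h0, iteratedDeriv_sub (le c4) (le c5), iteratedDeriv_sub (le c1) (le c2), iteratedDeriv_const_smul (le c3)]
        have i1 : iteratedDeriv n (translate (s + h) φ).1 t = iteratedDeriv n φ.1 (s + h + t) := by
          simp only [translate, iteratedDeriv_comp_const_add]
        have i2 : iteratedDeriv n (translate s φ).1 t = iteratedDeriv n φ.1 (s + t) := by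
          simp only [translate, iteratedDeriv_comp_const_add]
        have i3 : iteratedDeriv n (translate s (testDeriv φ)).1 t
            = iteratedDeriv n (deriv φ.1) (s + t) := by
          simp only [translate, testDeriv, iteratedDeriv_comp_const_add]
        rw [i1, i2, i3, ← iteratedDeriv_succ', iteratedDeriv_succ]
        simp [add_right_comm]
      rw [eq]
      refine second_order (contDiff_iteratedDeriv φ n) fun y hy => ?_
      have hy1 := abs_le.1 (hy.trans hh)
      have := hM (n + 2) (by omega) y ⟨by linarith [ht.1], by linarith [ht.2]⟩
      rwa [iteratedDeriv_succ, iteratedDeriv_succ] at this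
  rw [hasDerivAt_iff_isLittleO_nhds_zero]
  have O : (fun h : ℝ => f.pair (translate (s + h) φ) - f.pair (translate s φ)
        - h • f.pair (translate s (testDeriv φ))) =O[𝓝 0] fun h : ℝ => h ^ 2 := by
    refine Asymptotics.IsBigO.of_bound (C * M) ?_
    filter_upwards [Metric.closedBall_mem_nhds (0 : ℝ) one_pos] with h hh
    have := main h (by simpa using hh)
    rw [Complex.real_smul]
    refine this.trans (le_of_eq ?_)
    rw [Real.norm_eq_abs, abs_pow]; ring
  refine O.trans_isLittleO ?_
  simpa using (Asymptotics.isLittleO_pow_pow (𝕜 := ℝ) (show 1 < 2 by norm_num))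

theorem iterate_testDeriv (φ : halfLineTest) (n : ℕ) :
    (testDeriv^[n] φ).1 = iteratedDeriv n φ.1 := by
  induction n with
  | zero => simp
  | succ n ih =>
    rw [Function.iterate_succ_apply', iteratedDeriv_succ, ← ih]; rfl

theorem iteratedDeriv_pair_translate (f : HalfLineDistribution) (φ : halfLineTest) (n : ℕ) :
    iteratedDeriv n (fun s => f.pair (translate s φ))
      = fun s => f.pair (translate s (testDeriv^[n] φ)) := by
  induction n with
  | zero => simp
  | succ n ih =>
    rw [iteratedDeriv_succ, ih, Function.iterate_succ_apply']
    exact funext fun s => (hasDerivAt_pair_translate f _ s).deriv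

/-- The function `s ↦ ⟨f_t, φ(s + t)⟩` is again a test function. -/
def corr (f : HalfLineDistribution) (φ : halfLineTest) : halfLineTest :=
  ⟨fun s => f.pair (translate s φ), by
    refine contDiff_of_differentiable_iteratedDeriv (n := ⊤) fun m _ => ?_
    rw [iteratedDeriv_pair_translate]
    exact fun s => (hasDerivAt_pair_translate f _ s).differentiableAt, by
    obtain ⟨b, hb⟩ := φ.2.2
    obtain ⟨N, C, hC⟩ := f.bound 0
    refine ⟨b, fun s hs => ?_⟩
    have := hC (translate s φ) (fun t ht => hb _ (by linarith)) 0 le_rfl (fun n _ t ht => ?_)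
    · simpa using this
    · simp only [translate, iteratedDeriv_comp_const_add]
      rw [iteratedDeriv_vanish φ b hb n _ (by linarith [ht.1])]; simp⟩

/-- The convolution `f ⋆ g` of distributions on `[0, ∞)`:
`⟨f ⋆ g, φ⟩ = ⟨g_s, ⟨f_t, φ(s + t)⟩⟩`. -/
def conv (f g : HalfLineDistribution) : HalfLineDistribution where
  pair :=
    { toFun := fun φ => g.pair (corr f φ)
      map_add' := fun φ ψ => by
        rw [← map_add]; congr 1
        exact Subtype.ext (funext fun s => f.pair.map_add (translate s φ) (translate s ψ))
      map_smul' := fun a φ => by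
        rw [← map_smul]; congr 1
        exact Subtype.ext (funext fun s => f.pair.map_smul a (translate s φ)) }
  bound := by
    intro b
    obtain ⟨N, C, hC⟩ := g.bound b
    obtain ⟨N', C', hC'⟩ := f.bound b
    refine ⟨N + N', C * max C' 0, fun φ hφ M hM0 hM => ?_⟩
    have hv : ∀ s, b ≤ s → (corr f φ).1 s = 0 := by
      intro s hs
      obtain ⟨N0, C0, hC0⟩ := f.bound 0
      have := hC0 (translate s φ) (fun t ht => hφ _ (by linarith)) 0 le_rfl (fun n _ t ht => ?_)
      · simpa [corr] using this
      · simp only [translate, iteratedDeriv_comp_const_add]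
        rw [iteratedDeriv_vanish φ b hφ n _ (by linarith [ht.1])]; simp
    have := hC (corr f φ) hv (max C' 0 * M) (by positivity) (fun n hn s hs => ?_)
    · simpa [mul_assoc] using this
    · have e : iteratedDeriv n (corr f φ).1 s = f.pair (translate s (testDeriv^[n] φ)) := by
        simp only [corr, iteratedDeriv_pair_translate]
      rw [e]
      have h2 : ∀ m t, iteratedDeriv m (translate s (testDeriv^[n] φ)).1 t
          = iteratedDeriv (m + n) φ.1 (s + t) := by
        intro m t
        simp only [translate, iteratedDeriv_comp_const_add, iterate_testDeriv]
        rw [iteratedDeriv_eq_iterate, iteratedDeriv_eq_iterate, iteratedDeriv_eq_iterate,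
          Function.iterate_add_apply]
      have := hC' (translate s (testDeriv^[n] φ)) (fun t ht => ?_) M hM0 (fun m hm t ht => ?_)
      · exact this.trans (by gcongr; exact le_max_left _ _)
      · have := h2 0 t
        rw [iteratedDeriv_zero] at this
        rw [this]
        exact iteratedDeriv_vanish φ b hφ _ _ (by linarith [hs.1])
      · rw [h2]
        rcases le_total (s + t) b with h | h
        · exact hM _ (by omega) _ ⟨by linarith [hs.1, ht.1], h⟩
        · rw [iteratedDeriv_vanish φ b hφ _ _ h]; simpa using hM0

/-- The integrable weight `t^{-1/4}` on `(0, 1]`, `2 t^{-5/4}` on `(1, ∞)`. -/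
noncomputable def powWeight (t : ℝ) : ℝ :=
  if t ≤ 1 then t ^ (-(1 / 4) : ℝ) else 2 * t ^ (-(5 / 4) : ℝ)

theorem integrableOn_powWeight : IntegrableOn powWeight (Ioi 0) := by
  rw [← Ioc_union_Ioi_eq_Ioi (zero_le_one (α := ℝ))]
  refine IntegrableOn.union ?_ ?_
  · have h : IntegrableOn (fun t : ℝ => t ^ (-(1 / 4) : ℝ)) (Ioc 0 1) :=
      (intervalIntegrable_iff_integrableOn_Ioc_of_le zero_le_one).1
        (intervalIntegral.intervalIntegrable_rpow' (by norm_num))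
    refine h.congr_fun (fun t ht => ?_) measurableSet_Ioc
    simp [powWeight, ht.2]
  · have h : IntegrableOn (fun t : ℝ => 2 * t ^ (-(5 / 4) : ℝ)) (Ioi 1) :=
      (integrableOn_Ioi_rpow_of_lt (by norm_num) one_pos).const_mul 2
    refine h.congr_fun (fun t ht => ?_) measurableSet_Ioi
    simp [powWeight, not_le.2 (mem_Ioi.1 ht)]

theorem norm_pow_le (φ : halfLineTest) {M : ℝ}
    (hM : ∀ n ≤ 1, ∀ t, 0 ≤ t → ‖iteratedDeriv n φ.1 t‖ ≤ M) {t : ℝ} (ht : 0 < t) :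
    ‖((t ^ (-(5 / 4) : ℝ) : ℝ) : ℂ) * (φ.1 t - φ.1 0)‖ ≤ M * powWeight t := by
  have hp : 0 ≤ t ^ (-(5 / 4) : ℝ) := Real.rpow_nonneg ht.le _
  rw [norm_mul, Complex.norm_real, Real.norm_of_nonneg hp]
  unfold powWeight
  split_ifs with h
  · have h1 : ‖φ.1 t - φ.1 0‖ ≤ M * ‖t - 0‖ :=
      (convex_Ici (0 : ℝ)).norm_image_sub_le_of_norm_deriv_le
        (fun x _ => (contDiff_infty_iff_deriv.1 φ.2.1).1 x)
        (fun x hx => by simpa using hM 1 le_rfl x hx) (mem_Ici.2 le_rfl) (mem_Ici.2 ht.le)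
    rw [sub_zero, Real.norm_of_nonneg ht.le] at h1
    calc t ^ (-(5 / 4) : ℝ) * ‖φ.1 t - φ.1 0‖ ≤ t ^ (-(5 / 4) : ℝ) * (M * t) := by gcongr
      _ = M * (t ^ (-(5 / 4) : ℝ) * t ^ (1 : ℝ)) := by rw [Real.rpow_one]; ring
      _ = M * t ^ (-(1 / 4) : ℝ) := by rw [← Real.rpow_add ht]; norm_num
  · have h0 := hM 0 (by omega) t ht.le
    have h1 := hM 0 (by omega) 0 le_rfl
    rw [iteratedDeriv_zero] at h0 h1
    have h2 : ‖φ.1 t - φ.1 0‖ ≤ 2 * M := (norm_sub_le _ _).trans (by linarith)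
    calc t ^ (-(5 / 4) : ℝ) * ‖φ.1 t - φ.1 0‖ ≤ t ^ (-(5 / 4) : ℝ) * (2 * M) := by gcongr
      _ = M * (2 * t ^ (-(5 / 4) : ℝ)) := by ring

theorem bound_Ici (φ : halfLineTest) {b M : ℝ} (hb : ∀ t, b ≤ t → φ.1 t = 0) (hM0 : 0 ≤ M) (N : ℕ)
    (hM : ∀ n ≤ N, ∀ t ∈ Icc 0 b, ‖iteratedDeriv n φ.1 t‖ ≤ M) :
    ∀ n ≤ N, ∀ t, 0 ≤ t → ‖iteratedDeriv n φ.1 t‖ ≤ M := by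
  intro n hn t ht
  rcases le_total t b with h | h
  · exact hM n hn t ⟨ht, h⟩
  · rw [iteratedDeriv_vanish φ b hb n t h]; simpa using hM0

theorem integrableOn_pow (φ : halfLineTest) :
    IntegrableOn (fun t : ℝ => ((t ^ (-(5 / 4) : ℝ) : ℝ) : ℂ) * (φ.1 t - φ.1 0)) (Ioi 0) := by
  obtain ⟨b, hb⟩ := φ.2.2
  obtain ⟨M, hM0, hM⟩ := exists_bound φ 1 0 b
  have hφ := φ.2.1.continuous.measurable
  refine (integrableOn_powWeight.const_mul M).mono' ?_ ?_
  · exact Measurable.aestronglyMeasurable (by fun_prop)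
  · exact (ae_restrict_mem measurableSet_Ioi).mono fun t ht =>
      norm_pow_le φ (bound_Ici φ hb hM0 1 hM) ht

/-- The distribution `t_+^{-5/4}` on `[0, ∞)`, i.e. `t_+^{λ-1}` for `λ = -1/4`, defined as usual by
analytic continuation in `λ`; for `-1 < λ < 0` the continuation of `∫₀^∞ t^{λ-1} φ(t) dt` from
`Re λ > 0` is `∫₀^∞ t^{λ-1} (φ(t) - φ(0)) dt`.  If `φ(0) = 0` it is `∫₀^∞ t^{-5/4} φ(t) dt`. -/
noncomputable def tPow : HalfLineDistribution where
  pair :=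
    { toFun := fun φ => ∫ t in Ioi (0 : ℝ), ((t ^ (-(5 / 4) : ℝ) : ℝ) : ℂ) * (φ.1 t - φ.1 0)
      map_add' := fun φ ψ => by
        rw [← integral_add (integrableOn_pow φ) (integrableOn_pow ψ)]
        congr 1
        funext t
        simp only [Submodule.coe_add, Pi.add_apply]
        ring
      map_smul' := fun a φ => by
        rw [RingHom.id_apply, smul_eq_mul, ← integral_const_mul]
        congr 1
        funext t
        simp only [Submodule.coe_smul, Pi.smul_apply, smul_eq_mul]
        ring }
  bound := by
    intro b
    refine ⟨1, ∫ t in Ioi (0 : ℝ), powWeight t, fun φ hφ M hM0 hM => ?_⟩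
    have := norm_integral_le_of_norm_le (integrableOn_powWeight.const_mul M)
      ((ae_restrict_mem measurableSet_Ioi).mono fun t ht =>
        norm_pow_le φ (bound_Ici φ hφ hM0 1 hM) ht)
    rw [integral_const_mul, mul_comm] at this
    exact this

/-- The distribution `u` on `[0, ∞)` is the function `f`: `f` is integrable on bounded subintervals
of `[0, ∞)` and `⟨u, φ⟩ = ∫₀^∞ f(t) φ(t) dt`. -/
def IsFun (u : HalfLineDistribution) (f : ℝ → ℂ) : Prop :=
  LocallyIntegrableOn f (Ici 0) ∧ ∀ φ : halfLineTest, u.pair φ = ∫ t in Ioi (0 : ℝ), f t * φ.1 t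

/-- The equation `v = v₀ + t_+^{-5/4} ⋆ v`, tested against all the test functions on `[0, ∞)`. -/
def IsSolution (v₀ : ℝ → ℂ) (v : HalfLineDistribution) : Prop :=
  ∀ φ : halfLineTest,
    v.pair φ = (∫ t in Ioi (0 : ℝ), v₀ t * φ.1 t) + (conv tPow v).pair φ

/-- The equation `v = v₀ + t_+^{-5/4} ⋆ v`, tested only against the elements of `C₀^∞((0, ∞))`. -/
def IsSolutionOnIoi (v₀ : ℝ → ℂ) (v : HalfLineDistribution) : Prop :=
  ∀ φ : halfLineTest, (∃ a > 0, ∀ t ≤ a, φ.1 t = 0) →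
    v.pair φ = (∫ t in Ioi (0 : ℝ), v₀ t * φ.1 t) + (conv tPow v).pair φ

end HalfLineDistribution

/-- `v₀` vanishes for `t < 0`, is smooth on `[0, ∞)` (one-sided derivatives at `0`) and decays
rapidly with all its derivatives as `t → ∞`. -/
structure IsRapidlyDecayingSource (v₀ : ℝ → ℂ) : Prop where
  zero_of_neg : ∀ t < 0, v₀ t = 0
  smooth : ContDiffOn ℝ ∞ v₀ (Ici 0)
  decay : ∀ m n : ℕ, ∃ C : ℝ, ∀ t, 0 ≤ t → t ^ m * ‖iteratedDerivWithin n v₀ (Ici 0) t‖ ≤ C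

/-- The Laplace transform `L(f)(p) = ∫₀^∞ e^{-pt} f(t) dt`. -/
noncomputable def laplace (f : ℝ → ℂ) (p : ℂ) : ℂ :=
  ∫ t in Ioi (0 : ℝ), Complex.exp (-p * t) * f t

/-!
The equation is the transpose of an identity for operators on test functions. Write `T` for the
operator `φ ↦ (s ↦ ⟨t_+^{-5/4}, φ(s + t)⟩)`; a distribution `v` is a solution if and only if
`⟨v, (1 - T) φ⟩ = ∫ v₀ φ` for all `φ`. An integration by parts (`corrEnd_tPow`) shows that
`T = c K_{3/4} D` with `c = 4 Γ(3/4)`, where `D` is differentiation and `K_α` is fractional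
integration of order `α` from the right. Since `K_α K_β = K_{α+β}`, `K_1 D = -1` and `D` commutes
with all these operators, `k = c⁻¹ K_{1/4}` satisfies `T k = k T = -1`, and `k⁴ = a K_1` with
`a = c⁻⁴`. The operator `1 - k⁴` has the inverse `B = 1 + a H`, `H` being the correlation with
`e^{at}`. Hence `P = B (k - k² + k³ - k⁴)` is a two-sided inverse of `1 - T` on the test functions
(`one_sub_mul_solveEnd`, `solveEnd_mul_one_sub`), and the only solution is `ψ ↦ ∫ v₀ (P ψ)`.

Transposing `P` by Fubini's theorem, the solution is the function
`v = ∑_{j < 4} (-1)^j c^{-(j+1)} I^{(j+1)/4} (v₀ + a e^{a·} ⋆ v₀)`, where `I^α` is the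
Riemann–Liouville fractional integral. It is continuous, and its term of lowest order gives the
behaviour at `0`.

Up to a bounded function, `v₀ + a e^{a·} ⋆ v₀` is a multiple of `e^{at}`; each `I^{(j+1)/4}`
multiplies this exponential by `a^{-(j+1)/4} = c^{j+1}`, up to a bounded error, so that the
exponential terms of `v` add up to `1 - 1 + 1 - 1 = 0`. Therefore `v` grows at most linearly, and
its Laplace transform converges for `Re p > 0`. There it is computed from `v + k v = k v₀`
(with `k` now acting as `c⁻¹ I^{1/4}`), which follows from `P (1 + k) = k`.

If the equation is tested in `(0, ∞)` only, and `v = o(t^{-3/4})`, testing against cutoffs of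
width `r` at `0` shows that the full equation holds: `T` applied to such a cutoff is `O(r^{-1/4})`
and supported in `[0, r]`, where `|v|` has integral `o(r^{1/4})`.
-/

/-! ### Correlation operators and Fubini's theorem on the half-line -/

/-- Fubini's theorem for convolutions on the half-line: against a function that vanishes for large
`t`, the correlation with `h` is the transpose of the convolution with `h`. -/
theorem integral_mul_integral_translate {f h ψ : ℝ → ℂ} (hf : LocallyIntegrableOn f (Ici 0))
    (hh : LocallyIntegrableOn h (Ici 0)) (hψ : Continuous ψ) {b : ℝ}
    (hb : ∀ t, b ≤ t → ψ t = 0) :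
    ∫ s in Ioi (0 : ℝ), f s * ∫ t in Ioi (0 : ℝ), h t * ψ (s + t)
      = ∫ t in Ioi (0 : ℝ), (∫ s in (0 : ℝ)..t, f s * h (t - s)) * ψ t := by
  -- Only arguments in `[0, b]` contribute: truncating to this interval makes both factors
  -- integrable on `ℝ` and the test function bounded.
  have hI : ∀ g : ℝ → ℂ, LocallyIntegrableOn g (Ici 0) →
      Integrable (indicator (Ioc 0 b) g) := by
    intro g hg
    rw [integrable_indicator_iff measurableSet_Ioc]
    exact (hg.integrableOn_compact_subset Icc_subset_Ici_self isCompact_Icc).mono_set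
      Ioc_subset_Icc_self
  set f1 := indicator (Ioc 0 b) f with hf1
  set h1 := indicator (Ioc 0 b) h with hh1
  set ψ1 := indicator (Icc 0 b) ψ with hψ1
  obtain ⟨C, hC⟩ := (isCompact_Icc (a := (0 : ℝ)) (b := b)).exists_bound_of_continuousOn
    hψ.continuousOn
  have hψm : AEStronglyMeasurable (fun z : ℝ × ℝ => ψ1 z.1) (volume.prod volume) := by
    have : Measurable ψ1 := hψ.measurable.indicator measurableSet_Icc
    exact (this.comp measurable_fst).aestronglyMeasurable
  have hψb : ∀ x, ‖ψ1 x‖ ≤ max C 0 := by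
    intro x
    by_cases hx : x ∈ Icc 0 b
    · rw [hψ1, indicator_of_mem hx]; exact (hC x hx).trans (le_max_left _ _)
    · rw [hψ1, indicator_of_notMem hx]; simp
  have hint : Integrable (Function.uncurry fun x s : ℝ => f1 s * h1 (x - s) * ψ1 x)
      (volume.prod volume) := by
    have := (hI f hf).convolution_integrand (ContinuousLinearMap.mul ℝ ℂ) (hI h hh)
    exact this.mul_bdd (c := max C 0) hψm (Eventually.of_forall fun z => hψb z.1)
  have swap := integral_integral_swap hint
  -- The inner integral over `s` is the convolution on the half-line.
  have e1 : ∀ x, (∫ s, f1 s * h1 (x - s) * ψ1 x)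
      = indicator (Ioi 0) (fun t => (∫ s in (0 : ℝ)..t, f s * h (t - s)) * ψ t) x := by
    intro x
    rw [integral_mul_const]
    by_cases hx : 0 < x
    · rw [indicator_of_mem (mem_Ioi.2 hx)]
      by_cases hxb : x < b
      · rw [hψ1, indicator_of_mem (show x ∈ Icc 0 b from ⟨hx.le, hxb.le⟩),
          intervalIntegral.integral_of_le hx.le, integral_Ioc_eq_integral_Ioo,
          ← integral_indicator measurableSet_Ioo]
        congr 2
        funext s
        by_cases hs : s ∈ Ioo 0 x
        · rw [indicator_of_mem hs, hf1, hh1, indicator_of_mem, indicator_of_mem]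
          · exact ⟨by linarith [hs.2], by linarith [hs.1]⟩
          · exact ⟨by linarith [hs.1], by linarith [hs.2]⟩
        · rw [indicator_of_notMem hs]
          by_cases h0 : 0 < s
          · have : x ≤ s := by by_contra h; exact hs ⟨h0, not_le.1 h⟩
            rw [hh1, indicator_of_notMem, mul_zero]
            exact fun h => by linarith [h.1]
          · rw [hf1, indicator_of_notMem, zero_mul]
            exact fun h => h0 h.1
      · rw [hb x (not_lt.1 hxb)]
        have : ψ1 x = 0 := by
          by_cases hx' : x ∈ Icc 0 b
          · rw [hψ1, indicator_of_mem hx', hb x (not_lt.1 hxb)]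
          · rw [hψ1, indicator_of_notMem hx']
        rw [this, mul_zero, mul_zero]
    · rw [indicator_of_notMem (by simpa using hx)]
      have : (fun s => f1 s * h1 (x - s)) = fun _ => 0 := by
        funext s
        by_cases h0 : 0 < s
        · rw [hh1, indicator_of_notMem, mul_zero]
          exact fun h => by linarith [h.1]
        · rw [hf1, indicator_of_notMem, zero_mul]
          exact fun h => h0 h.1
      rw [this]; simp
  -- The inner integral over `x`, translated by `s`, is the correlation.
  have e2 : ∀ s, (∫ x, f1 s * h1 (x - s) * ψ1 x)
      = indicator (Ioi 0) (fun s => f s * ∫ t in Ioi (0 : ℝ), h t * ψ (s + t)) s := by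
    intro s
    simp_rw [mul_assoc]
    rw [integral_const_mul]
    by_cases h0 : 0 < s
    · rw [indicator_of_mem (mem_Ioi.2 h0)]
      by_cases hsb : s ≤ b
      · rw [hf1, indicator_of_mem (show s ∈ Ioc 0 b from ⟨h0, hsb⟩)]
        congr 1
        rw [← integral_add_left_eq_self _ s, ← integral_indicator measurableSet_Ioi]
        congr 1
        funext t
        rw [add_sub_cancel_left]
        by_cases ht : 0 < t
        · rw [indicator_of_mem (mem_Ioi.2 ht)]
          by_cases hst : s + t ≤ b
          · rw [hh1, hψ1, indicator_of_mem (show t ∈ Ioc 0 b from ⟨ht, by linarith⟩),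
              indicator_of_mem (show s + t ∈ Icc 0 b from ⟨by linarith, hst⟩)]
          · rw [hψ1, indicator_of_notMem (fun h => hst h.2), hb _ (not_le.1 hst).le, mul_zero,
              mul_zero]
        · rw [indicator_of_notMem (by simpa using ht), hh1, indicator_of_notMem, zero_mul]
          exact fun h => ht h.1
      · rw [hf1, indicator_of_notMem (fun h => hsb h.2), zero_mul]
        rw [setIntegral_eq_zero_of_forall_eq_zero, mul_zero]
        intro t ht
        rw [hb _ (by linarith [mem_Ioi.1 ht, not_le.1 hsb]), mul_zero]
    · rw [indicator_of_notMem (by simpa using h0), hf1, indicator_of_notMem, zero_mul]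
      exact fun h => h0 h.1
  simp_rw [e1, e2] at swap
  rw [integral_indicator measurableSet_Ioi, integral_indicator measurableSet_Ioi] at swap
  exact swap.symm

namespace HalfLineDistribution

theorem integrableOn_mul_test {h : ℝ → ℂ} (hh : LocallyIntegrableOn h (Ici 0)) (φ : halfLineTest) :
    IntegrableOn (fun t => h t * φ.1 t) (Ioi 0) := by
  obtain ⟨b, hb⟩ := φ.2.2
  have h1 : IntegrableOn (fun t => h t * φ.1 t) (Icc 0 b) :=
    (hh.integrableOn_compact_subset Icc_subset_Ici_self isCompact_Icc).mul_continuousOn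
      φ.2.1.continuous.continuousOn isCompact_Icc
  refine h1.of_forall_sdiff_eq_zero measurableSet_Ioi fun t ht => ?_
  have : b ≤ t := by
    by_contra h
    exact ht.2 ⟨(mem_Ioi.1 ht.1).le, (not_le.1 h).le⟩
  rw [hb t this, mul_zero]

/-- The distribution on `[0, ∞)` given by a locally integrable function. -/
noncomputable def ofFun (h : ℝ → ℂ) (hh : LocallyIntegrableOn h (Ici 0)) :
    HalfLineDistribution where
  pair :=
    { toFun := fun φ => ∫ t in Ioi (0 : ℝ), h t * φ.1 t
      map_add' := fun φ ψ => by
        rw [← integral_add (integrableOn_mul_test hh φ) (integrableOn_mul_test hh ψ)]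
        congr 1
        funext t
        simp only [Submodule.coe_add, Pi.add_apply]
        ring
      map_smul' := fun a φ => by
        rw [RingHom.id_apply, smul_eq_mul, ← integral_const_mul]
        congr 1
        funext t
        simp only [Submodule.coe_smul, Pi.smul_apply, smul_eq_mul]
        ring }
  bound := by
    intro b
    have hi : IntegrableOn (fun t => ‖h t‖) (Icc 0 b) :=
      (hh.integrableOn_compact_subset Icc_subset_Ici_self isCompact_Icc).norm
    refine ⟨0, ∫ t in Icc 0 b, ‖h t‖, fun φ hφ M hM0 hM => ?_⟩
    have e : ∫ t in Ioi (0 : ℝ), h t * φ.1 t = ∫ t in Ioc 0 b, h t * φ.1 t := by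
      refine setIntegral_eq_of_subset_of_forall_sdiff_eq_zero measurableSet_Ioi
        Ioc_subset_Ioi_self fun t ht => ?_
      have : b ≤ t := by
        by_contra h
        exact ht.2 ⟨ht.1, (not_le.1 h).le⟩
      rw [hφ t this, mul_zero]
    change ‖∫ t in Ioi (0 : ℝ), h t * φ.1 t‖ ≤ _
    rw [e, ← integral_Icc_eq_integral_Ioc, ← integral_mul_const]
    refine norm_integral_le_of_norm_le (hi.mul_const M) ?_
    refine (ae_restrict_mem measurableSet_Icc).mono fun t ht => ?_
    rw [norm_mul]
    gcongr
    simpa using hM 0 le_rfl t ht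

theorem ofFun_pair {h : ℝ → ℂ} (hh : LocallyIntegrableOn h (Ici 0)) (φ : halfLineTest) :
    (ofFun h hh).pair φ = ∫ t in Ioi (0 : ℝ), h t * φ.1 t := rfl

/-- The ring of linear operators on the test functions.  A type synonym of `Module.End`, so that
the ring structure is found without unfolding the additive structure of `halfLineTest`. -/
def TestOp : Type := Module.End ℂ halfLineTest

namespace TestOp

noncomputable instance : Ring TestOp := inferInstanceAs (Ring (Module.End ℂ halfLineTest))

noncomputable instance : Algebra ℂ TestOp :=
  inferInstanceAs (Algebra ℂ (Module.End ℂ halfLineTest))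

noncomputable instance : FunLike TestOp halfLineTest halfLineTest :=
  inferInstanceAs (FunLike (Module.End ℂ halfLineTest) halfLineTest halfLineTest)

theorem ext_apply {A B : TestOp} (h : ∀ φ s, (A φ).1 s = (B φ).1 s) : A = B :=
  DFunLike.ext _ _ fun φ => Subtype.ext (funext (h φ))

theorem mul_apply (A B : TestOp) (φ : halfLineTest) : (A * B) φ = A (B φ) := rfl
theorem one_apply (φ : halfLineTest) : (1 : TestOp) φ = φ := rfl
theorem add_apply (A B : TestOp) (φ : halfLineTest) : (A + B) φ = A φ + B φ := rfl
theorem sub_apply (A B : TestOp) (φ : halfLineTest) : (A - B) φ = A φ - B φ := rfl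
theorem smul_apply (z : ℂ) (A : TestOp) (φ : halfLineTest) : (z • A) φ = z • A φ := rfl

end TestOp

/-- The operator `φ ↦ (s ↦ ⟨f_t, φ(s + t)⟩)` on the test functions. -/
noncomputable def corrEnd (f : HalfLineDistribution) : TestOp :=
  ({ toFun := corr f
     map_add' := fun φ ψ =>
      Subtype.ext (funext fun s => f.pair.map_add (translate s φ) (translate s ψ))
     map_smul' := fun a φ =>
      Subtype.ext (funext fun s => f.pair.map_smul a (translate s φ)) } :
    halfLineTest →ₗ[ℂ] halfLineTest)

/-- Differentiation, as an operator on the test functions. -/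
noncomputable def derivEnd : TestOp :=
  ({ toFun := testDeriv
     map_add' := fun φ ψ => Subtype.ext (funext fun s =>
      deriv_add ((contDiff_infty_iff_deriv.1 φ.2.1).1 s) ((contDiff_infty_iff_deriv.1 ψ.2.1).1 s))
     map_smul' := fun a φ => Subtype.ext (funext fun s =>
      deriv_const_smul a ((contDiff_infty_iff_deriv.1 φ.2.1).1 s)) } :
    halfLineTest →ₗ[ℂ] halfLineTest)

theorem corrEnd_apply (f : HalfLineDistribution) (φ : halfLineTest) (s : ℝ) :
    (corrEnd f φ).1 s = f.pair (translate s φ) := rfl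

theorem derivEnd_apply (φ : halfLineTest) (s : ℝ) : (derivEnd φ).1 s = deriv φ.1 s := rfl

theorem corrEnd_ofFun_apply {h : ℝ → ℂ} (hh : LocallyIntegrableOn h (Ici 0)) (φ : halfLineTest)
    (s : ℝ) : (corrEnd (ofFun h hh) φ).1 s = ∫ t in Ioi (0 : ℝ), h t * φ.1 (s + t) := rfl

theorem derivEnd_mul_corrEnd (f : HalfLineDistribution) :
    derivEnd * corrEnd f = corrEnd f * derivEnd := by
  exact TestOp.ext_apply fun φ s => ((hasDerivAt_pair_translate f φ s).deriv)

/-- The transpose of the correlation with `h` is the convolution with `h`. -/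
theorem integral_mul_corrEnd_ofFun {f h g : ℝ → ℂ} (hf : LocallyIntegrableOn f (Ici 0))
    (hh : LocallyIntegrableOn h (Ici 0))
    (hg : ∀ t, 0 < t → ∫ s in (0 : ℝ)..t, f s * h (t - s) = g t) (φ : halfLineTest) :
    ∫ s in Ioi (0 : ℝ), f s * (corrEnd (ofFun h hh) φ).1 s = ∫ t in Ioi (0 : ℝ), g t * φ.1 t := by
  obtain ⟨b, hb⟩ := φ.2.2
  simp_rw [corrEnd_ofFun_apply]
  rw [integral_mul_integral_translate hf hh φ.2.1.continuous hb]
  exact setIntegral_congr_fun measurableSet_Ioi fun t ht => by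
    simp only [hg t (mem_Ioi.1 ht)]

/-- Correlation operators of functions compose according to the convolution of the functions. -/
theorem corrEnd_ofFun_mul {f h g : ℝ → ℂ} (hf : LocallyIntegrableOn f (Ici 0))
    (hh : LocallyIntegrableOn h (Ici 0)) (hg : LocallyIntegrableOn g (Ici 0))
    (hc : ∀ t, 0 < t → ∫ s in (0 : ℝ)..t, f s * h (t - s) = g t) :
    corrEnd (ofFun f hf) * corrEnd (ofFun h hh) = corrEnd (ofFun g hg) := by
  refine TestOp.ext_apply fun φ s => ?_
  rw [TestOp.mul_apply, corrEnd_ofFun_apply, corrEnd_ofFun_apply]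
  have := integral_mul_corrEnd_ofFun hf hh hc (translate s φ)
  refine Eq.trans ?_ this
  congr 1
  funext t
  rw [corrEnd_ofFun_apply, corrEnd_ofFun_apply]
  simp only [translate, add_assoc]

end HalfLineDistribution

/-! ### Fractional integration of test functions and the distribution `t_+^{-5/4}` -/

theorem locallyIntegrableOn_Ici_of_forall_Ioc {f : ℝ → ℂ}
    (h : ∀ b : ℝ, 0 ≤ b → IntegrableOn f (Ioc 0 b)) : LocallyIntegrableOn f (Ici 0) := by
  intro x hx
  refine ⟨Icc 0 (x + 1), ?_, ?_⟩
  · rw [← Ici_inter_Iic]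
    exact inter_mem self_mem_nhdsWithin (mem_nhdsWithin_of_mem_nhds (Iic_mem_nhds (by linarith)))
  · rw [integrableOn_Icc_iff_integrableOn_Ioc]
    exact h _ (by linarith [mem_Ici.1 hx])

/-- The kernel `t^{α-1} / Γ(α)` of fractional integration of order `α > 0`; only its values for
`t > 0` matter. -/
noncomputable def rieszKernel (α t : ℝ) : ℂ := ((t ^ (α - 1) / Real.Gamma α : ℝ) : ℂ)

theorem intervalIntegrable_rieszKernel {α : ℝ} (hα : 0 < α) (a b : ℝ) :
    IntervalIntegrable (rieszKernel α) volume a b := by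
  have h : IntervalIntegrable (fun t : ℝ => t ^ (α - 1) / Real.Gamma α) volume a b :=
    (intervalIntegral.intervalIntegrable_rpow' (by linarith)).div_const _
  exact ⟨h.1.ofReal, h.2.ofReal⟩

theorem locallyIntegrableOn_rieszKernel {α : ℝ} (hα : 0 < α) :
    LocallyIntegrableOn (rieszKernel α) (Ici 0) :=
  locallyIntegrableOn_Ici_of_forall_Ioc fun b hb =>
    (intervalIntegrable_iff_integrableOn_Ioc_of_le hb).1 (intervalIntegrable_rieszKernel hα 0 b)

theorem rieszKernel_one : rieszKernel 1 = fun _ => 1 := by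
  funext t; simp [rieszKernel]

theorem rieszKernel_eq_cpow {α t : ℝ} (ht : 0 ≤ t) :
    rieszKernel α t = (t : ℂ) ^ ((α : ℂ) - 1) / Complex.Gamma α := by
  rw [rieszKernel, Complex.ofReal_div, Complex.ofReal_cpow ht, Complex.Gamma_ofReal]
  push_cast; rfl

/-- The semigroup property of fractional integration, i.e. Euler's Beta integral. -/
theorem integral_rieszKernel_mul {α β t : ℝ} (hα : 0 < α) (hβ : 0 < β) (ht : 0 < t) :
    ∫ s in (0 : ℝ)..t, rieszKernel α s * rieszKernel β (t - s) = rieszKernel (α + β) t := by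
  have h1 : ∫ s in (0 : ℝ)..t, rieszKernel α s * rieszKernel β (t - s)
      = ∫ s in (0 : ℝ)..t, ((s : ℂ) ^ ((α : ℂ) - 1) * ((t : ℂ) - s) ^ ((β : ℂ) - 1))
          * (Complex.Gamma α * Complex.Gamma β)⁻¹ := by
    refine intervalIntegral.integral_congr fun s hs => ?_
    rw [uIcc_of_le ht.le] at hs
    rw [rieszKernel_eq_cpow hs.1, rieszKernel_eq_cpow (sub_nonneg.2 hs.2)]
    push_cast
    rw [mul_inv]; ring
  have hG := Complex.Gamma_mul_Gamma_eq_betaIntegral (s := α) (t := β) (by simpa) (by simpa)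
  have hα' : Complex.Gamma α ≠ 0 := Complex.Gamma_ne_zero_of_re_pos (by simpa)
  have hβ' : Complex.Gamma β ≠ 0 := Complex.Gamma_ne_zero_of_re_pos (by simpa)
  have hαβ : Complex.Gamma (α + β) ≠ 0 :=
    Complex.Gamma_ne_zero_of_re_pos (by simpa using add_pos hα hβ)
  rw [h1, intervalIntegral.integral_mul_const, Complex.betaIntegral_scaled _ _ ht,
    rieszKernel_eq_cpow ht.le]
  push_cast
  rw [hG]
  have hB : Complex.betaIntegral α β ≠ 0 := by
    intro h
    rw [h, mul_zero] at hG
    exact mul_ne_zero hα' hβ' hG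
  field_simp

theorem continuous_cexp_mul (a : ℂ) : Continuous fun t : ℝ => Complex.exp (a * t) := by fun_prop

theorem locallyIntegrableOn_cexp_mul (a : ℂ) :
    LocallyIntegrableOn (fun t : ℝ => Complex.exp (a * t)) (Ici 0) :=
  (continuous_cexp_mul a).locallyIntegrable.locallyIntegrableOn _

namespace HalfLineDistribution

/-- Fractional integration `φ ↦ (s ↦ ∫₀^∞ t^{α-1} φ(s + t) dt / Γ(α))` of order `α > 0` from the
right. -/
noncomputable def rieszEnd (α : ℝ) (hα : 0 < α) : TestOp :=
  corrEnd (ofFun (rieszKernel α) (locallyIntegrableOn_rieszKernel hα))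

/-- The operator `φ ↦ (s ↦ ∫₀^∞ e^{at} φ(s + t) dt)`. -/
noncomputable def expEnd (a : ℂ) : TestOp :=
  corrEnd (ofFun (fun t => Complex.exp (a * t)) (locallyIntegrableOn_cexp_mul a))

theorem rieszEnd_mul {α β γ : ℝ} (hα : 0 < α) (hβ : 0 < β) (hγ : 0 < γ) (h : α + β = γ) :
    rieszEnd α hα * rieszEnd β hβ = rieszEnd γ hγ := by
  subst h
  exact corrEnd_ofFun_mul _ _ _ fun t ht => integral_rieszKernel_mul hα hβ ht

/-- Integration by parts: `∫₀^∞ e^{at} φ'(s + t) dt = -φ(s) - a ∫₀^∞ e^{at} φ(s + t) dt`. -/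
theorem expEnd_mul_derivEnd (a : ℂ) : expEnd a * derivEnd = -1 - a • expEnd a := by
  refine TestOp.ext_apply fun φ s => ?_
  set ψ := translate s φ with hψ
  obtain ⟨b, hb⟩ := ψ.2.2
  have hd : Differentiable ℝ ψ.1 := (contDiff_infty_iff_deriv.1 ψ.2.1).1
  have hE : ∀ t : ℝ, HasDerivAt (fun t : ℝ => Complex.exp (a * t)) (Complex.exp (a * t) * a) t := by
    intro t
    have h1 : HasDerivAt (fun t : ℝ => a * (t : ℂ)) a t := by
      simpa using (Complex.ofRealCLM.hasDerivAt (x := t)).const_mul a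
    exact h1.cexp
  have i1 := integrableOn_mul_test (locallyIntegrableOn_cexp_mul a) ψ
  have i2 := integrableOn_mul_test (locallyIntegrableOn_cexp_mul a) (testDeriv ψ)
  have key := integral_Ioi_of_hasDerivAt_of_tendsto' (a := (0 : ℝ)) (m := 0)
    (f := fun t : ℝ => Complex.exp (a * t) * ψ.1 t)
    (f' := fun t : ℝ => a * (Complex.exp (a * t) * ψ.1 t)
      + Complex.exp (a * t) * (testDeriv ψ).1 t)
    (fun t _ => by
      have := (hE t).mul (hd t).hasDerivAt
      refine this.congr_deriv ?_
      simp only [testDeriv]; ring)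
    ((i1.const_mul a).add i2)
    (tendsto_const_nhds.congr' <| by
      filter_upwards [eventually_ge_atTop b] with t ht
      rw [hb t ht, mul_zero])
  rw [integral_add (i1.const_mul a) i2, integral_const_mul] at key
  have e1 : (corrEnd (ofFun _ (locallyIntegrableOn_cexp_mul a)) φ).1 s
      = ∫ t in Ioi (0 : ℝ), Complex.exp (a * t) * ψ.1 t := rfl
  have e2 : (corrEnd (ofFun _ (locallyIntegrableOn_cexp_mul a)) (derivEnd φ)).1 s
      = ∫ t in Ioi (0 : ℝ), Complex.exp (a * t) * (testDeriv ψ).1 t := by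
    rw [corrEnd_ofFun_apply]
    congr 1
    funext t
    simp only [hψ, testDeriv, translate, derivEnd_apply, deriv_comp_const_add]
  have e3 : ψ.1 0 = φ.1 s := by simp [hψ, translate]
  have e4 : ((-1 - a • expEnd a) φ).1 s = - φ.1 s - a * (expEnd a φ).1 s := rfl
  rw [e4, TestOp.mul_apply, expEnd, e1, e2]
  simp only [Complex.ofReal_zero, mul_zero, Complex.exp_zero, one_mul, e3] at key
  linear_combination key

/-- Fractional integration of order `1` is the case `a = 0` of the exponential kernel. -/
theorem rieszEnd_one_mul_derivEnd : rieszEnd 1 one_pos * derivEnd = -1 := by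
  have h : rieszEnd 1 one_pos = expEnd 0 := by
    unfold rieszEnd expEnd
    congr 2
    funext t; simp [rieszKernel_one]
  rw [h, expEnd_mul_derivEnd, zero_smul, sub_zero]

/-- Integration by parts turns the regularized integral defining `t_+^{-5/4}` into a fractional
integral of the derivative. -/
theorem tPow_pair_eq (φ : halfLineTest) :
    tPow.pair φ = 4 * ∫ t in Ioi (0 : ℝ), ((t ^ (-(1 / 4) : ℝ) : ℝ) : ℂ) * deriv φ.1 t := by
  obtain ⟨b, hb⟩ := φ.2.2
  have hd : Differentiable ℝ φ.1 := (contDiff_infty_iff_deriv.1 φ.2.1).1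
  have hloc : LocallyIntegrableOn (fun t : ℝ => ((t ^ (-(1 / 4) : ℝ) : ℝ) : ℂ)) (Ici 0) :=
    locallyIntegrableOn_Ici_of_forall_Ioc fun b hb =>
      ((intervalIntegrable_iff_integrableOn_Ioc_of_le hb).1
        (intervalIntegral.intervalIntegrable_rpow' (by norm_num))).ofReal
  have i1 := integrableOn_pow φ
  have i2 := integrableOn_mul_test hloc (testDeriv φ)
  -- The boundary term `-4 t^{-1/4} (φ(t) - φ(0))` vanishes at `0`, as `φ` is differentiable. (At
  -- `t = 0` itself the expression is `0` as well, whatever the value of `0 ^ (-1/4)`.)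
  have lim0 : Tendsto (fun t : ℝ => (-4 : ℂ) * (((t ^ (-(1 / 4) : ℝ) : ℝ) : ℂ)
      * (φ.1 t - φ.1 0))) (𝓝[>] 0) (𝓝 0) := by
    have h1 : Tendsto (fun t : ℝ => (((t ^ (3 / 4 : ℝ) : ℝ) : ℂ)
        * ((t : ℝ)⁻¹ • (φ.1 (0 + t) - φ.1 0)))) (𝓝[>] 0) (𝓝 (((0 : ℝ) : ℂ) * deriv φ.1 0)) := by
      refine Tendsto.mul ?_ ?_
      · have : Tendsto (fun t : ℝ => t ^ (3 / 4 : ℝ)) (𝓝 0) (𝓝 0) := by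
          simpa using (Real.continuousAt_rpow_const 0 (3 / 4) (Or.inr (by norm_num))).tendsto
        exact (Complex.continuous_ofReal.tendsto 0).comp (this.mono_left nhdsWithin_le_nhds)
      · exact (hasDerivAt_iff_tendsto_slope_zero.1 (hd 0).hasDerivAt).mono_left
          (nhdsWithin_mono _ fun t ht => (mem_Ioi.1 ht).ne')
    have h2 := h1.const_mul (-4 : ℂ)
    rw [Complex.ofReal_zero, zero_mul, mul_zero] at h2
    refine h2.congr' ?_
    filter_upwards [self_mem_nhdsWithin] with t ht
    have ht : (0 : ℝ) < t := ht
    have e : (t ^ (-(1 / 4) : ℝ)) = t ^ (3 / 4 : ℝ) * t⁻¹ := by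
      rw [← Real.rpow_neg_one, ← Real.rpow_add ht]; norm_num
    rw [e, zero_add, Complex.real_smul]
    push_cast
    ring
  have cont0 : ContinuousWithinAt (fun t : ℝ => (-4 : ℂ) * (((t ^ (-(1 / 4) : ℝ) : ℝ) : ℂ)
      * (φ.1 t - φ.1 0))) (Ici 0) 0 := by
    rw [← continuousWithinAt_Ioi_iff_Ici]
    unfold ContinuousWithinAt
    simpa using lim0
  have limT : Tendsto (fun t : ℝ => (-4 : ℂ) * (((t ^ (-(1 / 4) : ℝ) : ℝ) : ℂ)
      * (φ.1 t - φ.1 0))) atTop (𝓝 0) := by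
    have h1 : Tendsto (fun t : ℝ => ((t ^ (-(1 / 4) : ℝ) : ℝ) : ℂ)) atTop (𝓝 ((0 : ℝ) : ℂ)) :=
      (Complex.continuous_ofReal.tendsto 0).comp (tendsto_rpow_neg_atTop (by norm_num))
    have h2 := (h1.mul_const (- φ.1 0)).const_mul (-4 : ℂ)
    rw [Complex.ofReal_zero, zero_mul, mul_zero] at h2
    refine h2.congr' ?_
    filter_upwards [eventually_ge_atTop b] with t ht
    rw [hb t ht, zero_sub]
  have key := integral_Ioi_of_hasDerivAt_of_tendsto cont0
    (f' := fun t : ℝ => ((t ^ (-(5 / 4) : ℝ) : ℝ) : ℂ) * (φ.1 t - φ.1 0)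
      - 4 * (((t ^ (-(1 / 4) : ℝ) : ℝ) : ℂ) * (testDeriv φ).1 t))
    (fun t ht => by
      have h1 := ((Real.hasDerivAt_rpow_const (x := t) (p := (-(1 / 4) : ℝ))
        (Or.inl (mem_Ioi.1 ht).ne')).ofReal_comp.mul
          ((hd t).hasDerivAt.sub_const (φ.1 0))).const_mul (-4 : ℂ)
      refine h1.congr_deriv ?_
      rw [show (-(1 / 4) - 1 : ℝ) = -(5 / 4) by norm_num]
      simp only [testDeriv]
      push_cast
      ring)
    (i1.sub (i2.const_mul 4)) limT
  rw [integral_sub i1 (i2.const_mul 4), integral_const_mul] at key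
  have e1 : tPow.pair φ
      = ∫ t in Ioi (0 : ℝ), ((t ^ (-(5 / 4) : ℝ) : ℝ) : ℂ) * (φ.1 t - φ.1 0) := rfl
  have e2 : ∫ t in Ioi (0 : ℝ), ((t ^ (-(1 / 4) : ℝ) : ℝ) : ℂ) * deriv φ.1 t
      = ∫ t in Ioi (0 : ℝ), ((t ^ (-(1 / 4) : ℝ) : ℝ) : ℂ) * (testDeriv φ).1 t := rfl
  rw [e1, e2]
  rw [sub_self, mul_zero, mul_zero, sub_zero] at key
  linear_combination key

theorem corrEnd_tPow : corrEnd tPow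
    = ((4 * Real.Gamma (3 / 4) : ℝ) : ℂ) • (rieszEnd (3 / 4) (by norm_num) * derivEnd) := by
  refine TestOp.ext_apply fun φ s => ?_
  have e : ∀ (z : ℂ) (E : TestOp), ((z • E) φ).1 s = z * (E φ).1 s :=
    fun _ _ => rfl
  rw [e, corrEnd_apply, tPow_pair_eq, TestOp.mul_apply, rieszEnd, corrEnd_ofFun_apply]
  have hG : ((Real.Gamma (3 / 4) : ℝ) : ℂ) ≠ 0 := by
    exact_mod_cast (Real.Gamma_pos_of_pos (by norm_num)).ne'
  push_cast
  rw [mul_assoc, ← integral_const_mul (Real.Gamma (3 / 4) : ℂ)]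
  congr 2
  funext t
  rw [rieszKernel, derivEnd_apply]
  simp only [translate, deriv_comp_const_add]
  rw [show (3 / 4 - 1 : ℝ) = -(1 / 4) by norm_num]
  push_cast
  field_simp

end HalfLineDistribution

/-! ### The inverse of the transposed equation -/

section RingInverse

variable {R : Type*} [Ring R] {k T B : R}

/-- An inverse of `1 - k ^ 4` commutes with `k`. -/
theorem commute_of_inverse_one_sub_pow_four (h1 : B * (1 - k ^ 4) = 1) (h2 : (1 - k ^ 4) * B = 1) :
    B * k = k * B := by
  calc B * k = B * k * ((1 - k ^ 4) * B) := by rw [h2, mul_one]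
    _ = (B * (1 - k ^ 4)) * k * B := by noncomm_ring
    _ = k * B := by rw [h1, one_mul]

theorem one_sub_mul_eq_one (hT : T * k = -1) (h1 : B * (1 - k ^ 4) = 1)
    (h2 : (1 - k ^ 4) * B = 1) : (1 - T) * (B * (k - k ^ 2 + k ^ 3 - k ^ 4)) = 1 := by
  have hc : Commute B k := commute_of_inverse_one_sub_pow_four h1 h2
  have hc' : Commute B (k - k ^ 2 + k ^ 3 - k ^ 4) :=
    ((hc.sub_right (hc.pow_right 2)).add_right (hc.pow_right 3)).sub_right (hc.pow_right 4)
  rw [hc'.eq]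
  calc (1 - T) * ((k - k ^ 2 + k ^ 3 - k ^ 4) * B)
      = (k - T * k) * (1 - k + k ^ 2 - k ^ 3) * B := by noncomm_ring
    _ = (k + 1) * (1 - k + k ^ 2 - k ^ 3) * B := by rw [hT, sub_neg_eq_add]
    _ = (1 - k ^ 4) * B := by noncomm_ring
    _ = 1 := h2

theorem mul_one_sub_eq_one (hT : k * T = -1) (h1 : B * (1 - k ^ 4) = 1) :
    B * (k - k ^ 2 + k ^ 3 - k ^ 4) * (1 - T) = 1 := by
  calc B * (k - k ^ 2 + k ^ 3 - k ^ 4) * (1 - T)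
      = B * ((1 - k + k ^ 2 - k ^ 3) * (k - k * T)) := by noncomm_ring
    _ = B * ((1 - k + k ^ 2 - k ^ 3) * (k + 1)) := by rw [hT, sub_neg_eq_add]
    _ = B * (1 - k ^ 4) := by noncomm_ring
    _ = 1 := h1

theorem mul_one_add_eq (h1 : B * (1 - k ^ 4) = 1) :
    B * (k - k ^ 2 + k ^ 3 - k ^ 4) * (1 + k) = k := by
  calc B * (k - k ^ 2 + k ^ 3 - k ^ 4) * (1 + k) = B * (1 - k ^ 4) * k := by noncomm_ring
    _ = k := by rw [h1, one_mul]

end RingInverse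

/-- The constant `4 Γ(3/4) = -Γ(-1/4)`: the Laplace transform of `t_+^{-5/4}` is
`-4 Γ(3/4) p^{1/4}`. -/
noncomputable def symbolConst : ℝ := 4 * Real.Gamma (3 / 4)

theorem symbolConst_pos : 0 < symbolConst :=
  mul_pos (by norm_num) (Real.Gamma_pos_of_pos (by norm_num))

/-- The number `a = c⁻⁴`, `c = symbolConst`: the exponential rate at which the geometric series in
`(c p^{1/4})⁻⁴` has its pole. -/
noncomputable def growthRate : ℝ := symbolConst⁻¹ ^ 4

theorem growthRate_pos : 0 < growthRate := pow_pos (inv_pos.2 symbolConst_pos) 4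

namespace HalfLineDistribution

theorem derivEnd_mul_rieszEnd {α : ℝ} (hα : 0 < α) :
    derivEnd * rieszEnd α hα = rieszEnd α hα * derivEnd :=
  derivEnd_mul_corrEnd _

/-- Fractional integration of order `1/4`, normalized so that it is minus the inverse of the
correlation with `t_+^{-5/4}`. -/
noncomputable def abelEnd : TestOp :=
  ((symbolConst⁻¹ : ℝ) : ℂ) • rieszEnd (1 / 4) (by norm_num)

theorem abelEnd_pow_succ (j : ℕ) : abelEnd ^ (j + 1)
    = ((symbolConst⁻¹ ^ (j + 1) : ℝ) : ℂ) • rieszEnd (((j + 1 : ℕ) : ℝ) / 4) (by positivity) := by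
  induction j with
  | zero => simp [abelEnd]
  | succ j ih =>
    rw [pow_succ, ih, abelEnd, smul_mul_smul_comm, rieszEnd_mul (γ := ((j + 1 + 1 : ℕ) : ℝ) / 4)
      _ _ (by positivity) (by push_cast; ring), ← Complex.ofReal_mul, ← pow_succ]

theorem corrEnd_tPow_mul_abelEnd : corrEnd tPow * abelEnd = -1 := by
  rw [corrEnd_tPow, abelEnd, smul_mul_smul_comm, mul_assoc, derivEnd_mul_rieszEnd,
    ← mul_assoc, rieszEnd_mul _ _ one_pos (by norm_num), rieszEnd_one_mul_derivEnd]
  have : ((4 * Real.Gamma (3 / 4) : ℝ) : ℂ) * ((symbolConst⁻¹ : ℝ) : ℂ) = 1 := by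
    rw [← Complex.ofReal_mul]
    exact_mod_cast mul_inv_cancel₀ symbolConst_pos.ne'
  rw [this, one_smul]

theorem abelEnd_mul_corrEnd_tPow : abelEnd * corrEnd tPow = -1 := by
  rw [corrEnd_tPow, abelEnd, smul_mul_smul_comm, ← mul_assoc,
    rieszEnd_mul _ _ one_pos (by norm_num), rieszEnd_one_mul_derivEnd]
  have : ((symbolConst⁻¹ : ℝ) : ℂ) * ((4 * Real.Gamma (3 / 4) : ℝ) : ℂ) = 1 := by
    rw [← Complex.ofReal_mul]
    exact_mod_cast inv_mul_cancel₀ symbolConst_pos.ne'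
  rw [this, one_smul]

/-- The inverse of `1 - abelEnd ^ 4`, where `abelEnd ^ 4` is `growthRate` times integration. -/
noncomputable def resolventEnd : TestOp :=
  1 + (growthRate : ℂ) • expEnd growthRate

theorem abelEnd_pow_four : abelEnd ^ 4 = (growthRate : ℂ) • rieszEnd 1 one_pos := by
  rw [abelEnd_pow_succ 3]
  congr 2
  norm_num

/-- The resolvent equation of integration, with the exponential on the left. -/
theorem expEnd_mul_rieszEnd_one (a : ℂ) :
    expEnd a = rieszEnd 1 one_pos + a • (expEnd a * rieszEnd 1 one_pos) := by
  have h : expEnd a * (derivEnd * rieszEnd 1 one_pos) = -expEnd a := by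
    rw [derivEnd_mul_rieszEnd, rieszEnd_one_mul_derivEnd, mul_neg, mul_one]
  rw [← mul_assoc, expEnd_mul_derivEnd, sub_mul, neg_mul, one_mul, smul_mul_assoc] at h
  rw [← neg_inj, ← h]
  abel

/-- The resolvent equation of integration, with the exponential on the right. -/
theorem rieszEnd_one_mul_expEnd (a : ℂ) :
    expEnd a = rieszEnd 1 one_pos + a • (rieszEnd 1 one_pos * expEnd a) := by
  have h : rieszEnd 1 one_pos * (derivEnd * expEnd a) = -expEnd a := by
    rw [← mul_assoc, rieszEnd_one_mul_derivEnd, neg_mul, one_mul]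
  rw [expEnd, derivEnd_mul_corrEnd, ← expEnd, expEnd_mul_derivEnd, mul_sub, mul_neg, mul_one,
    mul_smul_comm] at h
  rw [← neg_inj, ← h]
  abel

theorem resolventEnd_mul : resolventEnd * (1 - abelEnd ^ 4) = 1 := by
  rw [abelEnd_pow_four, resolventEnd, add_mul, mul_sub, mul_sub, one_mul, one_mul, mul_one,
    smul_mul_smul_comm, mul_smul]
  conv_lhs => enter [2, 1]; rw [expEnd_mul_rieszEnd_one]
  rw [smul_add]
  abel

theorem mul_resolventEnd : (1 - abelEnd ^ 4) * resolventEnd = 1 := by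
  rw [abelEnd_pow_four, resolventEnd, mul_add, sub_mul, sub_mul, one_mul, one_mul, mul_one,
    smul_mul_smul_comm, mul_smul]
  conv_lhs => enter [2, 1]; rw [rieszEnd_one_mul_expEnd]
  rw [smul_add]
  abel

/-- The inverse of the operator `1 - corrEnd tPow`, which is the transpose of
`v ↦ v - t_+^{-5/4} ⋆ v`. -/
noncomputable def solveEnd : TestOp :=
  resolventEnd * (abelEnd - abelEnd ^ 2 + abelEnd ^ 3 - abelEnd ^ 4)

theorem one_sub_mul_solveEnd : (1 - corrEnd tPow) * solveEnd = 1 :=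
  one_sub_mul_eq_one corrEnd_tPow_mul_abelEnd resolventEnd_mul mul_resolventEnd

theorem solveEnd_mul_one_sub : solveEnd * (1 - corrEnd tPow) = 1 :=
  mul_one_sub_eq_one abelEnd_mul_corrEnd_tPow resolventEnd_mul

/-- The transpose of the Volterra equation `v + k v = k v₀` with Abel's kernel `k`. -/
theorem solveEnd_mul_one_add : solveEnd * (1 + abelEnd) = abelEnd :=
  mul_one_add_eq resolventEnd_mul

/-- The equation is the transpose of the operator `1 - corrEnd tPow` on test functions. -/
theorem isSolution_iff (v₀ : ℝ → ℂ) (v : HalfLineDistribution) : v.IsSolution v₀ ↔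
    ∀ φ, v.pair ((1 - corrEnd tPow) φ) = ∫ t in Ioi (0 : ℝ), v₀ t * φ.1 t := by
  refine forall_congr' fun φ => ?_
  have e : v.pair ((1 - corrEnd tPow) φ) = v.pair φ - (conv tPow v).pair φ := by
    rw [TestOp.sub_apply, TestOp.one_apply, map_sub]; rfl
  rw [e, sub_eq_iff_eq_add]

/-- A distribution solves the equation if and only if it is the transpose of `solveEnd` applied
to the source. -/
theorem isSolution_iff_pair_eq (v₀ : ℝ → ℂ) (v : HalfLineDistribution) : v.IsSolution v₀ ↔
    ∀ ψ, v.pair ψ = ∫ t in Ioi (0 : ℝ), v₀ t * (solveEnd ψ).1 t := by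
  rw [isSolution_iff]
  constructor
  · intro h ψ
    rw [← h, ← TestOp.mul_apply, one_sub_mul_solveEnd, TestOp.one_apply]
  · intro h φ
    rw [h, ← TestOp.mul_apply, solveEnd_mul_one_sub, TestOp.one_apply]

end HalfLineDistribution

/-! ### Fractional integrals of functions and the solution as a function -/

/-- The fractional integral `∫₀ᵗ f(s) (t - s)^{α-1} ds / Γ(α)` for `t ≥ 0`, and `0` for `t < 0`.
It is written with the variable rescaled to `[0, 1]`, which displays its continuity and its
behaviour at `0`. -/
noncomputable def fracIntegral (α : ℝ) (f : ℝ → ℂ) (t : ℝ) : ℂ :=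
  (((max t 0) ^ α : ℝ) : ℂ) * ∫ x in (0 : ℝ)..1, f (t * x) * rieszKernel α (1 - x)

theorem fracIntegral_of_nonpos {α : ℝ} (hα : 0 < α) (f : ℝ → ℂ) {t : ℝ} (ht : t ≤ 0) :
    fracIntegral α f t = 0 := by
  rw [fracIntegral, max_eq_right ht, Real.zero_rpow hα.ne', Complex.ofReal_zero, zero_mul]

theorem fracIntegral_eq_integral {α : ℝ} (f : ℝ → ℂ) {t : ℝ} (ht : 0 < t) :
    ∫ s in (0 : ℝ)..t, f s * rieszKernel α (t - s) = fracIntegral α f t := by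
  have h := intervalIntegral.smul_integral_comp_mul_left (a := 0) (b := 1)
    (fun s => f s * rieszKernel α (t - s)) t
  rw [mul_zero, mul_one] at h
  rw [← h, fracIntegral, max_eq_left ht.le, Complex.real_smul,
    ← intervalIntegral.integral_const_mul, ← intervalIntegral.integral_const_mul]
  refine intervalIntegral.integral_congr fun x hx => ?_
  rw [uIcc_of_le zero_le_one] at hx
  have e : t * (t - t * x) ^ (α - 1) = t ^ α * (1 - x) ^ (α - 1) := by
    rw [show t - t * x = t * (1 - x) by ring, Real.mul_rpow ht.le (by linarith [hx.2]),
      ← mul_assoc]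
    congr 1
    nth_rewrite 1 [← Real.rpow_one t]
    rw [← Real.rpow_add ht]; congr 1; ring
  have e' : (t : ℂ) * (((t - t * x) ^ (α - 1) : ℝ) : ℂ)
      = ((t ^ α : ℝ) : ℂ) * (((1 - x) ^ (α - 1) : ℝ) : ℂ) := by
    rw [← Complex.ofReal_mul, e, Complex.ofReal_mul]
  simp only [rieszKernel, Complex.ofReal_div]
  rw [← mul_div_assoc, ← mul_div_assoc, ← mul_div_assoc, ← mul_div_assoc, mul_left_comm, e']
  ring

theorem continuous_integral_mul_rieszKernel {α : ℝ} (hα : 0 < α) {f : ℝ → ℂ} (hf : Continuous f) :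
    Continuous fun t : ℝ => ∫ x in (0 : ℝ)..1, f (t * x) * rieszKernel α (1 - x) := by
  have hk : IntervalIntegrable (fun x => rieszKernel α (1 - x)) volume 0 1 := by
    have := (intervalIntegrable_rieszKernel hα 0 1).comp_sub_left (1 : ℝ)
    simpa using this.symm
  rw [continuous_iff_continuousAt]
  intro t₀
  obtain ⟨M, hM⟩ := (isCompact_Icc (a := -(|t₀| + 1)) (b := |t₀| + 1)).exists_bound_of_continuousOn
    hf.continuousOn
  refine intervalIntegral.continuousAt_of_dominated_interval
    (bound := fun x => M * ‖rieszKernel α (1 - x)‖) ?_ ?_ (hk.norm.const_mul M) ?_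
  · refine Eventually.of_forall fun t => ?_
    exact (by fun_prop : Continuous fun x => f (t * x)).aestronglyMeasurable.mul
      (by simpa [uIoc_of_le] using hk.1.aestronglyMeasurable)
  · filter_upwards [Metric.ball_mem_nhds t₀ one_pos] with t ht
    refine Eventually.of_forall fun x hx => ?_
    rw [uIoc_of_le zero_le_one] at hx
    rw [norm_mul]
    gcongr
    refine hM _ (abs_le.1 ?_)
    have h1 : |t| ≤ |t₀| + 1 := by
      have : |t - t₀| < 1 := by simpa [Real.dist_eq] using ht
      have := abs_sub_abs_le_abs_sub t t₀
      linarith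
    rw [abs_mul, abs_of_pos hx.1]
    calc |t| * x ≤ |t| * 1 := by gcongr; exact hx.2
      _ ≤ _ := by linarith
  · refine Eventually.of_forall fun x _ => ?_
    exact (by fun_prop : Continuous fun t => f (t * x) * rieszKernel α (1 - x)).continuousAt

theorem continuous_fracIntegral {α : ℝ} (hα : 0 < α) {f : ℝ → ℂ} (hf : Continuous f) :
    Continuous (fracIntegral α f) := by
  refine Continuous.mul ?_ (continuous_integral_mul_rieszKernel hα hf)
  exact Complex.continuous_ofReal.comp
    ((continuous_id.max continuous_const).rpow_const fun _ => Or.inr hα.le)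

/-- A fractional integral of order `α` behaves like `f(0) t^α / Γ(α + 1)` at `0`. -/
theorem tendsto_fracIntegral_div {α : ℝ} (hα : 0 < α) {f : ℝ → ℂ} (hf : Continuous f) :
    Tendsto (fun t : ℝ => fracIntegral α f t / ((t ^ α : ℝ) : ℂ)) (𝓝[>] 0)
      (𝓝 (f 0 / Complex.Gamma (α + 1))) := by
  have h0 : ∫ x in (0 : ℝ)..1, f (0 * x) * rieszKernel α (1 - x)
      = f 0 / Complex.Gamma (α + 1) := by
    simp only [zero_mul]
    rw [intervalIntegral.integral_const_mul]
    have := integral_rieszKernel_mul one_pos hα (one_pos (α := ℝ))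
    simp only [rieszKernel_one, one_mul] at this
    rw [this, rieszKernel_eq_cpow zero_le_one]
    push_cast
    rw [Complex.one_cpow, add_comm (1 : ℂ), mul_one_div]
  have h1 := ((continuous_integral_mul_rieszKernel hα hf).tendsto 0).mono_left
    (nhdsWithin_le_nhds (s := Ioi 0))
  rw [h0] at h1
  refine h1.congr' ?_
  filter_upwards [self_mem_nhdsWithin] with t ht
  have ht : (0 : ℝ) < t := ht
  have : ((t ^ α : ℝ) : ℂ) ≠ 0 := Complex.ofReal_ne_zero.2 (Real.rpow_pos_of_pos ht α).ne'
  rw [fracIntegral, max_eq_left ht.le, mul_div_cancel_left₀ _ this]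

/-- The function `f + a e^{a·} ⋆ f`, i.e. the solution `g` of `g = f + a ∫₀ᵗ g`. -/
noncomputable def expConv (a : ℝ) (f : ℝ → ℂ) (t : ℝ) : ℂ :=
  f t + a * ∫ s in (0 : ℝ)..t, f s * Complex.exp (a * ((t - s : ℝ) : ℂ))

theorem integral_mul_cexp_sub (a : ℝ) (f : ℝ → ℂ) (t : ℝ) :
    ∫ s in (0 : ℝ)..t, f s * Complex.exp (a * ((t - s : ℝ) : ℂ))
      = Complex.exp (a * t) * ∫ s in (0 : ℝ)..t, Complex.exp (-a * s) * f s := by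
  rw [← intervalIntegral.integral_const_mul]
  congr 1
  funext s
  rw [← mul_assoc, ← Complex.exp_add, mul_comm]
  congr 2
  push_cast; ring

theorem continuous_integral_mul_cexp_sub (a : ℝ) {f : ℝ → ℂ} (hf : Continuous f) :
    Continuous fun t : ℝ => ∫ s in (0 : ℝ)..t, f s * Complex.exp (a * ((t - s : ℝ) : ℂ)) := by
  simp_rw [integral_mul_cexp_sub]
  have hg : Continuous fun s : ℝ => Complex.exp (-a * s) * f s := by fun_prop
  have h := intervalIntegral.continuous_primitive (μ := volume)
    (fun _ _ => hg.intervalIntegrable _ _) 0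
  fun_prop

theorem continuous_expConv (a : ℝ) {f : ℝ → ℂ} (hf : Continuous f) :
    Continuous (expConv a f) :=
  hf.add (continuous_const.mul (continuous_integral_mul_cexp_sub a hf))

theorem expConv_zero (a : ℝ) (f : ℝ → ℂ) : expConv a f 0 = f 0 := by
  simp [expConv]

namespace HalfLineDistribution

theorem integral_mul_rieszEnd {α : ℝ} (hα : 0 < α) {f : ℝ → ℂ} (hf : Continuous f)
    (φ : halfLineTest) :
    ∫ t in Ioi (0 : ℝ), f t * (rieszEnd α hα φ).1 t
      = ∫ t in Ioi (0 : ℝ), fracIntegral α f t * φ.1 t :=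
  integral_mul_corrEnd_ofFun (hf.locallyIntegrable.locallyIntegrableOn _) _
    (fun _ ht => fracIntegral_eq_integral f ht) φ

theorem integral_mul_one_add_expEnd (a : ℝ) {f : ℝ → ℂ} (hf : Continuous f) (φ : halfLineTest) :
    ∫ t in Ioi (0 : ℝ), f t * ((1 + (a : ℂ) • expEnd a : TestOp) φ).1 t
      = ∫ t in Ioi (0 : ℝ), expConv a f t * φ.1 t := by
  have hl : ∀ {g : ℝ → ℂ}, Continuous g → LocallyIntegrableOn g (Ici 0) :=
    fun hg => hg.locallyIntegrable.locallyIntegrableOn _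
  have h1 := integral_mul_corrEnd_ofFun (hl hf) (locallyIntegrableOn_cexp_mul a)
    (fun t _ => rfl) φ
  have hc := continuous_integral_mul_cexp_sub a hf
  have e1 : ∀ t, f t * ((1 + (a : ℂ) • expEnd a : TestOp) φ).1 t
      = f t * φ.1 t + a * (f t * (expEnd a φ).1 t) := by
    intro t
    rw [TestOp.add_apply, TestOp.one_apply, TestOp.smul_apply]
    simp only [Submodule.coe_add, Submodule.coe_smul, Pi.add_apply, Pi.smul_apply, smul_eq_mul]
    ring
  simp_rw [e1, expConv, add_mul, mul_assoc]
  rw [integral_add (integrableOn_mul_test (hl hf) φ)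
    ((integrableOn_mul_test (hl hf) (expEnd a φ)).const_mul _),
    integral_add (integrableOn_mul_test (hl hf) φ)
    ((integrableOn_mul_test (hl hc) φ).const_mul _), integral_const_mul, integral_const_mul]
  congr 2

end HalfLineDistribution

/-- The continuous extension of the source to `ℝ` by its value at `0`. -/
noncomputable def sourceExt (v₀ : ℝ → ℂ) (t : ℝ) : ℂ := v₀ (max t 0)

/-- The coefficients `(-1)^j c^{-(j+1)}`, `c = 4 Γ(3/4)`, of the solution. -/
noncomputable def solCoeff (j : ℕ) : ℂ := ((((-1) ^ j * symbolConst⁻¹ ^ (j + 1)) : ℝ) : ℂ)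

/-- The order `(j + 1) / 4` of the fractional integrals in the solution. -/
noncomputable def solOrder (j : ℕ) : ℝ := ((j + 1 : ℕ) : ℝ) / 4

theorem solOrder_pos (j : ℕ) : 0 < solOrder j := by unfold solOrder; positivity

/-- The solution of the equation as a function: the transpose of `solveEnd` applied to the source,
with the exponential factor applied first. It vanishes for `t ≤ 0`. -/
noncomputable def solution (v₀ : ℝ → ℂ) (t : ℝ) : ℂ :=
  ∑ j ∈ Finset.range 4,
    solCoeff j * fracIntegral (solOrder j) (expConv growthRate (sourceExt v₀)) t

theorem IsRapidlyDecayingSource.continuous_sourceExt {v₀ : ℝ → ℂ}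
    (h : IsRapidlyDecayingSource v₀) : Continuous (sourceExt v₀) :=
  h.smooth.continuousOn.comp_continuous (continuous_id.max continuous_const)
    fun _ => mem_Ici.2 (le_max_right _ _)

theorem sourceExt_of_nonneg (v₀ : ℝ → ℂ) {t : ℝ} (ht : 0 ≤ t) : sourceExt v₀ t = v₀ t := by
  rw [sourceExt, max_eq_left ht]

theorem continuous_solution {v₀ : ℝ → ℂ} (h : IsRapidlyDecayingSource v₀) :
    Continuous (solution v₀) :=
  continuous_finsetSum _ fun j _ => continuous_const.mul
    (continuous_fracIntegral (solOrder_pos j) (continuous_expConv _ h.continuous_sourceExt))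

theorem solution_of_nonpos (v₀ : ℝ → ℂ) {t : ℝ} (ht : t ≤ 0) : solution v₀ t = 0 :=
  Finset.sum_eq_zero fun j _ => by rw [fracIntegral_of_nonpos (solOrder_pos j) _ ht, mul_zero]

namespace HalfLineDistribution

theorem abelEnd_alternating_sum : abelEnd - abelEnd ^ 2 + abelEnd ^ 3 - abelEnd ^ 4
    = ∑ j ∈ Finset.range 4, solCoeff j • rieszEnd (solOrder j) (solOrder_pos j) := by
  have h : ∀ j, solCoeff j • rieszEnd (solOrder j) (solOrder_pos j)
      = ((-1 : ℂ) ^ j) • abelEnd ^ (j + 1) := by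
    intro j
    rw [abelEnd_pow_succ, smul_smul, solCoeff]
    congr 1
    push_cast; rfl
  simp_rw [h, Finset.sum_range_succ, Finset.sum_range_zero]
  norm_num
  abel

theorem pair_sum_smul (w : HalfLineDistribution) (φ : halfLineTest) (s : Finset ℕ) (z : ℕ → ℂ)
    (A : ℕ → TestOp) :
    w.pair ((∑ j ∈ s, z j • A j) φ) = ∑ j ∈ s, z j * w.pair (A j φ) := by
  induction s using Finset.cons_induction with
  | empty => exact w.pair.map_zero
  | cons j s hj ih =>
    rw [Finset.sum_cons, Finset.sum_cons, TestOp.add_apply, map_add, ih, TestOp.smul_apply,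
      map_smul, smul_eq_mul]

/-- The function `solution v₀` is the transpose of `solveEnd` applied to `v₀`. -/
theorem integral_solution_mul {v₀ : ℝ → ℂ} (h : IsRapidlyDecayingSource v₀) (φ : halfLineTest) :
    ∫ t in Ioi (0 : ℝ), v₀ t * (solveEnd φ).1 t = ∫ t in Ioi (0 : ℝ), solution v₀ t * φ.1 t := by
  have hl : ∀ {g : ℝ → ℂ}, Continuous g → LocallyIntegrableOn g (Ici 0) :=
    fun hg => hg.locallyIntegrable.locallyIntegrableOn _
  have hc := h.continuous_sourceExt
  have hE := continuous_expConv growthRate hc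
  have e1 : ∫ t in Ioi (0 : ℝ), v₀ t * (solveEnd φ).1 t
      = ∫ t in Ioi (0 : ℝ), sourceExt v₀ t * (solveEnd φ).1 t :=
    setIntegral_congr_fun measurableSet_Ioi fun t ht => by
      rw [sourceExt_of_nonneg v₀ (mem_Ioi.1 ht).le]
  rw [e1, solveEnd, TestOp.mul_apply, resolventEnd, integral_mul_one_add_expEnd _ hc,
    ← ofFun_pair (hl hE), abelEnd_alternating_sum, pair_sum_smul]
  simp_rw [ofFun_pair, integral_mul_rieszEnd _ hE, solution, Finset.sum_mul, mul_assoc]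
  rw [integral_finsetSum]
  · simp_rw [integral_const_mul]
  · intro j _
    exact (integrableOn_mul_test (hl (continuous_fracIntegral (solOrder_pos j) hE)) φ).const_mul _

end HalfLineDistribution

/-! ### Laplace transforms of fractional integrals -/

theorem laplace_rieszKernel_ofReal {α r : ℝ} (hα : 0 < α) (hr : 0 < r) :
    laplace (rieszKernel α) r = ((r ^ (-α) : ℝ) : ℂ) := by
  have h := Real.integral_rpow_mul_exp_neg_mul_Ioi hα hr
  have e : laplace (rieszKernel α) r
      = ∫ t in Ioi (0 : ℝ), (((t ^ (α - 1) * Real.exp (-(r * t))) / Real.Gamma α : ℝ) : ℂ) := by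
    unfold laplace rieszKernel
    congr 1
    funext t
    push_cast
    rw [neg_mul]; ring
  rw [e, integral_complex_ofReal, integral_div, h, one_div, Real.inv_rpow hr.le,
    Real.rpow_neg hr.le,
    mul_div_cancel_right₀ _ (Real.Gamma_pos_of_pos hα).ne']

theorem integrableOn_exp_mul_rieszKernel {α r : ℝ} (hα : 0 < α) (hr : 0 < r) :
    IntegrableOn (fun t : ℝ => t ^ (α - 1) / Real.Gamma α * Real.exp (-(r * t))) (Ioi 0) := by
  have h := (integrableOn_rpow_mul_exp_neg_mul_rpow (p := 1) (s := α - 1) (b := r)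
    (by linarith) one_pos hr).div_const (Real.Gamma α)
  refine IntegrableOn.congr_fun h (fun t _ => ?_) measurableSet_Ioi
  simp only [Real.rpow_one, neg_mul]
  ring

theorem integrableOn_cexp_mul_rieszKernel {α : ℝ} (hα : 0 < α) {p : ℂ} (hp : 0 < p.re) :
    IntegrableOn (fun t : ℝ => Complex.exp (-p * t) * rieszKernel α t) (Ioi 0) := by
  refine (integrableOn_exp_mul_rieszKernel hα hp).mono' ?_ ?_
  · exact (continuous_cexp_mul (-p)).aestronglyMeasurable.mul
      ((locallyIntegrableOn_rieszKernel hα).aestronglyMeasurable.mono_set Ioi_subset_Ici_self)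
  · filter_upwards [ae_restrict_mem measurableSet_Ioi] with t ht
    have hpos : 0 ≤ t ^ (α - 1) / Real.Gamma α :=
      div_nonneg (Real.rpow_nonneg (mem_Ioi.1 ht).le _) (Real.Gamma_pos_of_pos hα).le
    rw [norm_mul, Complex.norm_exp, rieszKernel, Complex.norm_real, Real.norm_of_nonneg hpos,
      mul_comm]
    simp

/-- The Laplace transform of `t^{α-1} / Γ(α)`, by analytic continuation from real `p`. -/
theorem laplace_rieszKernel {α : ℝ} (hα : 0 < α) {p : ℂ} (hp : 0 < p.re) :
    laplace (rieszKernel α) p = p ^ (-α : ℂ) := by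
  -- Holomorphy in `p` is that of the complex moment generating function of the measure with
  -- density `t^{α-1} / Γ(α)`.
  set ρ : ℝ → NNReal := fun t => Real.toNNReal (t ^ (α - 1) / Real.Gamma α) with hρ
  have hρm : Measurable ρ := by fun_prop
  set μ : Measure ℝ := (volume.restrict (Ioi 0)).withDensity (fun t => (ρ t : ENNReal)) with hμ
  have hρv : ∀ t ∈ Ioi (0 : ℝ), (ρ t : ℝ) = t ^ (α - 1) / Real.Gamma α := fun t ht =>
    Real.coe_toNNReal _
      (div_nonneg (Real.rpow_nonneg (mem_Ioi.1 ht).le _) (Real.Gamma_pos_of_pos hα).le)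
  have hset : Iio 0 ⊆ interior (ProbabilityTheory.integrableExpSet id μ) := by
    rw [isOpen_Iio.subset_interior_iff]
    intro r hr
    have hr : 0 < -r := neg_pos.2 hr
    change Integrable (fun t => Real.exp (r * id t)) μ
    rw [hμ, integrable_withDensity_iff_integrable_smul hρm]
    refine IntegrableOn.congr_fun (integrableOn_exp_mul_rieszKernel hα hr) (fun t ht => ?_)
      measurableSet_Ioi
    simp only [NNReal.smul_def, hρv t ht, smul_eq_mul, neg_mul, neg_neg, id]
  have hF : ∀ q : ℂ, ProbabilityTheory.complexMGF id μ (-q) = laplace (rieszKernel α) q := by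
    intro q
    rw [ProbabilityTheory.complexMGF, hμ, integral_withDensity_eq_integral_smul hρm, laplace]
    refine setIntegral_congr_fun measurableSet_Ioi fun t ht => ?_
    simp only [NNReal.smul_def, hρv t ht, Complex.real_smul, rieszKernel, id]
    ring
  have hpre : IsPreconnected {q : ℂ | 0 < q.re} :=
    (convex_halfSpace_re_gt 0).isPreconnected
  have hopen : IsOpen {q : ℂ | 0 < q.re} := isOpen_lt continuous_const Complex.continuous_re
  have a1 : AnalyticOnNhd ℂ (laplace (rieszKernel α)) {q : ℂ | 0 < q.re} := by
    refine DifferentiableOn.analyticOnNhd (fun q hq => ?_) hopen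
    have h1 := (ProbabilityTheory.hasDerivAt_complexMGF (X := id) (μ := μ) (z := -q)
      (hset (by simpa using hq))).differentiableAt
    have h2 := h1.comp q differentiableAt_id.neg
    rw [show (ProbabilityTheory.complexMGF id μ ∘ Neg.neg) = laplace (rieszKernel α) from
      funext fun z => hF z] at h2
    exact h2.differentiableWithinAt
  have a2 : AnalyticOnNhd ℂ (fun q : ℂ => q ^ (-α : ℂ)) {q : ℂ | 0 < q.re} := by
    refine DifferentiableOn.analyticOnNhd (fun q hq => ?_) hopen
    exact (differentiableAt_id.cpow_const (Or.inl hq)).differentiableWithinAt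
  have hfreq : ∃ᶠ q in 𝓝[≠] (1 : ℂ), laplace (rieszKernel α) q = q ^ (-α : ℂ) := by
    have ht : Tendsto (fun r : ℝ => (r : ℂ)) (𝓝[≠] 1) (𝓝[≠] 1) := by
      refine tendsto_nhdsWithin_iff.2 ⟨?_, ?_⟩
      · exact (Complex.continuous_ofReal.tendsto' 1 1 Complex.ofReal_one).mono_left
          nhdsWithin_le_nhds
      · filter_upwards [self_mem_nhdsWithin] with r hr
        exact fun h => hr (Complex.ofReal_eq_one.1 h)
    refine ht.frequently (Eventually.frequently ?_)
    filter_upwards [mem_nhdsWithin_of_mem_nhds (lt_mem_nhds one_pos)] with r hr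
    rw [laplace_rieszKernel_ofReal hα hr, Complex.ofReal_cpow hr.le, Complex.ofReal_neg]
  exact a1.eqOn_of_preconnected_of_frequently_eq a2 hpre (by simp) hfreq hp

/-- Multiplication by `e^{-pt}` is compatible with convolution. -/
theorem cexp_mul_fracIntegral {α : ℝ} (f : ℝ → ℂ) (p : ℂ) {t : ℝ} (ht : 0 < t) :
    ∫ s in (0 : ℝ)..t, (Complex.exp (-p * s) * f s)
        * (Complex.exp (-p * ((t - s : ℝ) : ℂ)) * rieszKernel α (t - s))
      = Complex.exp (-p * t) * fracIntegral α f t := by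
  rw [← fracIntegral_eq_integral f ht, ← intervalIntegral.integral_const_mul]
  congr 1
  funext s
  have : Complex.exp (-p * t) = Complex.exp (-p * s) * Complex.exp (-p * ((t - s : ℝ) : ℂ)) := by
    rw [← Complex.exp_add]; congr 1; push_cast; ring
  rw [this]; ring

theorem integrableOn_cexp_mul_fracIntegral {α : ℝ} (hα : 0 < α) {f : ℝ → ℂ} {p : ℂ}
    (hp : 0 < p.re) (hf : IntegrableOn (fun t : ℝ => Complex.exp (-p * t) * f t) (Ioi 0)) :
    IntegrableOn (fun t : ℝ => Complex.exp (-p * t) * fracIntegral α f t) (Ioi 0) := by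
  have h := (integrable_posConvolution hf (integrableOn_cexp_mul_rieszKernel hα hp)
    (ContinuousLinearMap.mul ℝ ℂ)).integrableOn (s := Ioi 0)
  refine IntegrableOn.congr_fun h (fun t ht => ?_) measurableSet_Ioi
  rw [posConvolution, indicator_of_mem ht]
  exact cexp_mul_fracIntegral f p ht

theorem laplace_fracIntegral {α : ℝ} (hα : 0 < α) {f : ℝ → ℂ} {p : ℂ}
    (hp : 0 < p.re) (hf : IntegrableOn (fun t : ℝ => Complex.exp (-p * t) * f t) (Ioi 0)) :
    laplace (fracIntegral α f) p = laplace f p * p ^ (-α : ℂ) := by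
  have h := integral_posConvolution hf (integrableOn_cexp_mul_rieszKernel hα hp)
    (ContinuousLinearMap.mul ℝ ℂ)
  rw [← laplace_rieszKernel hα hp]
  refine Eq.trans ?_ h
  exact setIntegral_congr_fun measurableSet_Ioi fun t ht => (cexp_mul_fracIntegral f p ht).symm

theorem integrableOn_cexp_mul_of_linear_growth {f : ℝ → ℂ} (hf : Continuous f) {C : ℝ}
    (hC : ∀ t, 0 ≤ t → ‖f t‖ ≤ C * (1 + t)) {p : ℂ} (hp : 0 < p.re) :
    IntegrableOn (fun t : ℝ => Complex.exp (-p * t) * f t) (Ioi 0) := by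
  have hC0 : 0 ≤ C := by
    have := (norm_nonneg _).trans (hC 0 le_rfl)
    simpa using this
  set x := p.re with hx
  have h2 : 0 < x / 2 := by linarith
  refine ((exp_neg_integrableOn_Ioi 0 h2).const_mul (C * (1 + 2 / x))).mono' ?_ ?_
  · exact ((continuous_cexp_mul (-p)).mul hf).aestronglyMeasurable
  · filter_upwards [ae_restrict_mem measurableSet_Ioi] with t ht
    have ht : 0 < t := ht
    have e1 : x / 2 * t + 1 ≤ Real.exp (x / 2 * t) := Real.add_one_le_exp _
    have e2 : 1 + t ≤ (1 + 2 / x) * Real.exp (x / 2 * t) := by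
      have e3 : t = 2 / x * (x / 2 * t) := by field_simp
      have e4 : t ≤ 2 / x * Real.exp (x / 2 * t) := by
        nth_rewrite 1 [e3]
        gcongr; linarith
      have e5 : 1 ≤ Real.exp (x / 2 * t) := Real.one_le_exp (by positivity)
      linarith
    have e6 : ‖Complex.exp (-p * t)‖ = Real.exp (-(x / 2) * t) * Real.exp (-(x / 2) * t) := by
      rw [Complex.norm_exp, ← Real.exp_add]
      congr 1
      simp [hx]; ring
    have e7 : Real.exp (-(x / 2) * t) * Real.exp (x / 2 * t) = 1 := by
      rw [← Real.exp_add]; simp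
    rw [norm_mul, e6]
    calc Real.exp (-(x / 2) * t) * Real.exp (-(x / 2) * t) * ‖f t‖
        ≤ Real.exp (-(x / 2) * t) * Real.exp (-(x / 2) * t)
          * (C * ((1 + 2 / x) * Real.exp (x / 2 * t))) := by
          gcongr; exact (hC t ht.le).trans (by gcongr)
      _ = C * (1 + 2 / x) * Real.exp (-(x / 2) * t)
          * (Real.exp (-(x / 2) * t) * Real.exp (x / 2 * t)) := by ring
      _ = _ := by rw [e7, mul_one]

/-! ### Linear growth and the Laplace transform of the solution -/

/-- For bounded `f`, the function `f + a e^{a·} ⋆ f` is a multiple of `e^{at}`, up to a bounded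
error: the tail `∫_t^∞ e^{-as} f(s) ds` is `O(e^{-at})`. -/
theorem norm_expConv_sub_le {a M : ℝ} (ha : 0 < a) {f : ℝ → ℂ} (hf : Continuous f)
    (hM : ∀ t, ‖f t‖ ≤ M) {t : ℝ} (ht : 0 ≤ t) :
    ‖expConv a f t - a * laplace f a * Complex.exp (a * t)‖ ≤ 2 * M := by
  have hint : IntegrableOn (fun s : ℝ => Complex.exp (-a * s) * f s) (Ioi 0) := by
    refine integrableOn_cexp_mul_of_linear_growth (p := a) hf (C := M) (fun s hs => ?_) (by simpa)
    have : 0 ≤ M := (norm_nonneg _).trans (hM 0)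
    exact (hM s).trans (le_mul_of_one_le_right this (by linarith))
  have hsplit : laplace f a = (∫ s in (0 : ℝ)..t, Complex.exp (-a * s) * f s)
      + ∫ s in Ioi t, Complex.exp (-a * s) * f s := by
    rw [intervalIntegral.integral_of_le ht, laplace, ← Ioc_union_Ioi_eq_Ioi ht]
    exact setIntegral_union (Ioc_disjoint_Ioi le_rfl) measurableSet_Ioi
      (hint.mono_set Ioc_subset_Ioi_self) (hint.mono_set (Ioi_subset_Ioi ht))
  have hd : expConv a f t - a * laplace f a * Complex.exp (a * t)
      = f t - a * (Complex.exp (a * t) * ∫ s in Ioi t, Complex.exp (-a * s) * f s) := by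
    rw [expConv, integral_mul_cexp_sub, hsplit]; ring
  have htail : ‖∫ s in Ioi t, Complex.exp (-a * s) * f s‖ ≤ M * (Real.exp (-a * t) / a) := by
    have h1 : ∫ s in Ioi t, M * Real.exp (-a * s) = M * (Real.exp (-a * t) / a) := by
      rw [integral_const_mul, integral_exp_mul_Ioi (by linarith)]
      congr 1
      rw [neg_div_neg_eq]
    rw [← h1]
    refine norm_integral_le_of_norm_le ((exp_neg_integrableOn_Ioi t ha).const_mul M)
      (Eventually.of_forall fun s => ?_)
    rw [norm_mul, Complex.norm_exp, mul_comm]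
    simp only [Complex.mul_re, Complex.neg_re, Complex.ofReal_re, Complex.neg_im,
      Complex.ofReal_im, mul_zero, sub_zero]
    gcongr
    exact hM s
  have hexp : ‖Complex.exp (a * t)‖ = Real.exp (a * t) := by
    rw [Complex.norm_exp]; simp
  have h1 : Real.exp (a * t) * Real.exp (-a * t) = 1 := by rw [← Real.exp_add]; simp
  rw [hd]
  calc _ ≤ ‖f t‖ + ‖(a : ℂ) * (Complex.exp (a * t) * ∫ s in Ioi t, Complex.exp (-a * s) * f s)‖ :=
        norm_sub_le _ _
    _ = ‖f t‖ + a * (Real.exp (a * t) * ‖∫ s in Ioi t, Complex.exp (-a * s) * f s‖) := by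
        rw [norm_mul, norm_mul, hexp, Complex.norm_real, Real.norm_of_nonneg ha.le]
    _ ≤ M + a * (Real.exp (a * t) * (M * (Real.exp (-a * t) / a))) := by
        gcongr; exact hM t
    _ = M + M * (Real.exp (a * t) * Real.exp (-a * t)) := by field_simp
    _ = 2 * M := by rw [h1]; ring

theorem norm_rieszKernel {α t : ℝ} (hα : 0 < α) (ht : 0 ≤ t) :
    ‖rieszKernel α t‖ = t ^ (α - 1) / Real.Gamma α := by
  rw [rieszKernel, Complex.norm_real, Real.norm_of_nonneg
    (div_nonneg (Real.rpow_nonneg ht _) (Real.Gamma_pos_of_pos hα).le)]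

/-- A bound `M` for `f` gives the bound `M t^α / Γ(α + 1)` for the fractional integral. -/
theorem norm_fracIntegral_le {α M : ℝ} (hα : 0 < α) {f : ℝ → ℂ} {t : ℝ} (ht : 0 < t)
    (hM : ∀ s ∈ Ioc 0 t, ‖f s‖ ≤ M) :
    ‖fracIntegral α f t‖ ≤ M * ‖rieszKernel (α + 1) t‖ := by
  have hk : IntervalIntegrable (fun s => rieszKernel α (t - s)) volume 0 t := by
    have := (intervalIntegrable_rieszKernel hα 0 t).comp_sub_left t
    simpa using this.symm
  have h1 := integral_rieszKernel_mul one_pos hα ht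
  simp only [rieszKernel_one, one_mul] at h1
  have h2 : ∫ s in (0 : ℝ)..t, ‖rieszKernel α (t - s)‖ = ‖rieszKernel (α + 1) t‖ := by
    have e : ∫ s in (0 : ℝ)..t, rieszKernel α (t - s)
        = ((∫ s in (0 : ℝ)..t, ‖rieszKernel α (t - s)‖ : ℝ) : ℂ) := by
      rw [← intervalIntegral.integral_ofReal]
      refine intervalIntegral.integral_congr fun s hs => ?_
      rw [uIcc_of_le ht.le] at hs
      rw [norm_rieszKernel hα (sub_nonneg.2 hs.2), rieszKernel]
    have hn : 0 ≤ ∫ s in (0 : ℝ)..t, ‖rieszKernel α (t - s)‖ :=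
      intervalIntegral.integral_nonneg ht.le fun _ _ => norm_nonneg _
    rw [add_comm α, ← h1, e, Complex.norm_real, Real.norm_of_nonneg hn]
  rw [← fracIntegral_eq_integral f ht, ← h2, ← intervalIntegral.integral_const_mul]
  refine intervalIntegral.norm_integral_le_of_norm_le ht.le ?_ (hk.norm.const_mul M)
  refine Eventually.of_forall fun s hs => ?_
  rw [norm_mul]
  gcongr
  exact hM s hs

theorem fracIntegral_sub_const_mul {α : ℝ} (hα : 0 < α) {f g : ℝ → ℂ} (hf : Continuous f)
    (hg : Continuous g) (z : ℂ) {t : ℝ} (ht : 0 < t) :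
    fracIntegral α (fun s => f s - z * g s) t = fracIntegral α f t - z * fracIntegral α g t := by
  have hk : IntervalIntegrable (fun s => rieszKernel α (t - s)) volume 0 t := by
    have := (intervalIntegrable_rieszKernel hα 0 t).comp_sub_left t
    simpa using this.symm
  rw [← fracIntegral_eq_integral _ ht, ← fracIntegral_eq_integral _ ht,
    ← fracIntegral_eq_integral _ ht, ← intervalIntegral.integral_const_mul,
    ← intervalIntegral.integral_sub]
  · congr 1; funext s; ring
  · exact hk.continuousOn_mul hf.continuousOn
  · exact (hk.continuousOn_mul hg.continuousOn).const_mul z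

/-- The fractional integral of an exponential is again that exponential, up to the factor given
by the Laplace transform of the kernel and a bounded error. -/
theorem norm_fracIntegral_exp_sub_le {α a : ℝ} (hα : 0 < α) (hα1 : α ≤ 1) (ha : 0 < a) {t : ℝ}
    (ht : 1 ≤ t) :
    ‖fracIntegral α (fun s : ℝ => Complex.exp (a * s)) t
      - ((a ^ (-α) : ℝ) : ℂ) * Complex.exp (a * t)‖ ≤ (Real.Gamma α * a)⁻¹ := by
  have ht0 : 0 < t := by linarith
  have hint := integrableOn_cexp_mul_rieszKernel hα (p := a) (by simpa)
  have hsplit : laplace (rieszKernel α) a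
      = (∫ s in (0 : ℝ)..t, Complex.exp (-a * s) * rieszKernel α s)
        + ∫ s in Ioi t, Complex.exp (-a * s) * rieszKernel α s := by
    rw [intervalIntegral.integral_of_le ht0.le, laplace, ← Ioc_union_Ioi_eq_Ioi ht0.le]
    exact setIntegral_union (Ioc_disjoint_Ioi le_rfl) measurableSet_Ioi
      (hint.mono_set Ioc_subset_Ioi_self) (hint.mono_set (Ioi_subset_Ioi ht0.le))
  have hfrac : fracIntegral α (fun s : ℝ => Complex.exp (a * s)) t
      = Complex.exp (a * t) * ∫ s in (0 : ℝ)..t, Complex.exp (-a * s) * rieszKernel α s := by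
    rw [← fracIntegral_eq_integral _ ht0, ← integral_mul_cexp_sub]
    have := intervalIntegral.integral_comp_sub_left (a := 0) (b := t)
      (fun s => rieszKernel α s * Complex.exp (a * ((t - s : ℝ) : ℂ))) t
    simp only [sub_sub_cancel, sub_zero, sub_self] at this
    rw [← this]
    congr 1; funext s; ring
  have hG := Real.Gamma_pos_of_pos hα
  have htail : ‖∫ s in Ioi t, Complex.exp (-a * s) * rieszKernel α s‖
      ≤ (Real.Gamma α)⁻¹ * (Real.exp (-a * t) / a) := by
    have h1 : ∫ s in Ioi t, (Real.Gamma α)⁻¹ * Real.exp (-a * s)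
        = (Real.Gamma α)⁻¹ * (Real.exp (-a * t) / a) := by
      rw [integral_const_mul, integral_exp_mul_Ioi (by linarith)]
      congr 1
      rw [neg_div_neg_eq]
    rw [← h1]
    refine norm_integral_le_of_norm_le ((exp_neg_integrableOn_Ioi t ha).const_mul _) ?_
    filter_upwards [ae_restrict_mem measurableSet_Ioi] with s hs
    have hs : t < s := hs
    rw [norm_mul, Complex.norm_exp, mul_comm, norm_rieszKernel hα (by linarith)]
    simp only [Complex.mul_re, Complex.neg_re, Complex.ofReal_re, Complex.neg_im,
      Complex.ofReal_im, mul_zero, sub_zero]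
    rw [← one_div]
    gcongr
    exact Real.rpow_le_one_of_one_le_of_nonpos (by linarith) (by linarith)
  have hexp : ‖Complex.exp (a * t)‖ = Real.exp (a * t) := by
    rw [Complex.norm_exp]; simp
  have h1 : Real.exp (a * t) * Real.exp (-a * t) = 1 := by rw [← Real.exp_add]; simp
  have hd : fracIntegral α (fun s : ℝ => Complex.exp (a * s)) t
      - ((a ^ (-α) : ℝ) : ℂ) * Complex.exp (a * t)
      = -(Complex.exp (a * t) * ∫ s in Ioi t, Complex.exp (-a * s) * rieszKernel α s) := by
    rw [hfrac, ← laplace_rieszKernel_ofReal hα ha, hsplit]; ring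
  rw [hd, norm_neg, norm_mul, hexp]
  calc _ ≤ Real.exp (a * t) * ((Real.Gamma α)⁻¹ * (Real.exp (-a * t) / a)) := by gcongr
    _ = (Real.exp (a * t) * Real.exp (-a * t)) * (Real.Gamma α * a)⁻¹ := by
        rw [mul_inv]; ring
    _ = _ := by rw [h1, one_mul]

theorem solOrder_le_one {j : ℕ} (hj : j ∈ Finset.range 4) : solOrder j ≤ 1 := by
  have : ((j + 1 : ℕ) : ℝ) ≤ 4 := by exact_mod_cast Finset.mem_range.1 hj
  unfold solOrder; linarith

/-- The exponentially growing contributions of the four fractional integrals cancel. -/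
theorem sum_solCoeff_mul_rpow :
    ∑ j ∈ Finset.range 4, solCoeff j * ((growthRate ^ (-solOrder j) : ℝ) : ℂ) = 0 := by
  have h : ∀ j, solCoeff j * ((growthRate ^ (-solOrder j) : ℝ) : ℂ) = (-1) ^ j := by
    intro j
    have hc := symbolConst_pos
    have e : growthRate ^ (-solOrder j) = symbolConst ^ (j + 1) := by
      rw [growthRate, inv_pow, Real.inv_rpow (by positivity), Real.rpow_neg (by positivity),
        inv_inv, solOrder, ← Real.rpow_natCast symbolConst 4, ← Real.rpow_mul hc.le,
        ← Real.rpow_natCast symbolConst (j + 1)]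
      congr 1
      push_cast; ring
    rw [e, solCoeff, ← Complex.ofReal_mul, mul_assoc, ← mul_pow, inv_mul_cancel₀ hc.ne', one_pow]
    simp
  simp_rw [h]
  norm_num [Finset.sum_range_succ]

theorem IsRapidlyDecayingSource.exists_bound_sourceExt {v₀ : ℝ → ℂ}
    (h : IsRapidlyDecayingSource v₀) : ∃ M, ∀ t, ‖sourceExt v₀ t‖ ≤ M := by
  obtain ⟨M, hM⟩ := h.decay 0 0
  refine ⟨M, fun t => ?_⟩
  have := hM (max t 0) (le_max_right _ _)
  simpa [sourceExt] using this

/-- The solution grows at most linearly, because the exponential terms of its four summands cancel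
and what remains are fractional integrals, of order at most `1`, of a bounded function. -/
theorem exists_linear_growth_solution {v₀ : ℝ → ℂ} (h : IsRapidlyDecayingSource v₀) :
    ∃ C : ℝ, ∀ t, 0 ≤ t → ‖solution v₀ t‖ ≤ C * (1 + t) := by
  obtain ⟨M, hM⟩ := h.exists_bound_sourceExt
  have hM0 : 0 ≤ M := (norm_nonneg _).trans (hM 0)
  have hc := h.continuous_sourceExt
  set a := growthRate with ha
  have ha0 : 0 < a := growthRate_pos
  set A : ℂ := a * laplace (sourceExt v₀) a with hA
  set g := expConv a (sourceExt v₀) with hg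
  have hgc : Continuous g := continuous_expConv a hc
  have hec := continuous_cexp_mul a
  have key : ∀ j ∈ Finset.range 4, ∀ t : ℝ, 1 ≤ t →
      ‖fracIntegral (solOrder j) g t
        - A * (((a ^ (-solOrder j) : ℝ) : ℂ) * Complex.exp (a * t))‖
      ≤ (2 * M / Real.Gamma (solOrder j + 1)
        + ‖A‖ * (Real.Gamma (solOrder j) * a)⁻¹) * t := by
    intro j hj t ht
    have ht0 : 0 < t := by linarith
    have hα := solOrder_pos j
    have hα1 := solOrder_le_one hj
    set α := solOrder j
    have hG := Real.Gamma_pos_of_pos hα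
    have hG' := Real.Gamma_pos_of_pos (show 0 < α + 1 by linarith)
    have b1 : ‖fracIntegral α (fun s => g s - A * Complex.exp (a * s)) t‖
        ≤ 2 * M / Real.Gamma (α + 1) * t := by
      refine (norm_fracIntegral_le hα ht0 (M := 2 * M) fun s hs =>
        norm_expConv_sub_le ha0 hc hM hs.1.le).trans ?_
      rw [norm_rieszKernel (by linarith) ht0.le, add_sub_cancel_right, mul_div_assoc',
        div_mul_eq_mul_div]
      gcongr
      exact Real.rpow_le_self_of_one_le ht hα1
    rw [fracIntegral_sub_const_mul hα hgc hec _ ht0] at b1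
    have b2 := norm_fracIntegral_exp_sub_le hα hα1 ha0 ht
    set F := fracIntegral α (fun s : ℝ => Complex.exp (a * s)) t
    set E := ((a ^ (-α) : ℝ) : ℂ) * Complex.exp (a * t)
    calc ‖fracIntegral α g t - A * E‖ = ‖(fracIntegral α g t - A * F) + A * (F - E)‖ := by
          congr 1; ring
      _ ≤ ‖fracIntegral α g t - A * F‖ + ‖A‖ * ‖F - E‖ := by
          rw [← norm_mul]; exact norm_add_le _ _
      _ ≤ 2 * M / Real.Gamma (α + 1) * t + ‖A‖ * (Real.Gamma α * a)⁻¹ * t := by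
          refine add_le_add b1 ?_
          refine (mul_le_mul_of_nonneg_left b2 (norm_nonneg A)).trans ?_
          exact le_mul_of_one_le_right (by positivity) ht
      _ = _ := by ring
  set K : ℝ := ∑ j ∈ Finset.range 4, ‖solCoeff j‖ * (2 * M / Real.Gamma (solOrder j + 1)
        + ‖A‖ * (Real.Gamma (solOrder j) * a)⁻¹) with hK
  have hlarge : ∀ t : ℝ, 1 ≤ t → ‖solution v₀ t‖ ≤ K * t := by
    intro t ht
    have e : solution v₀ t = ∑ j ∈ Finset.range 4, solCoeff j * (fracIntegral (solOrder j) g t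
        - A * (((a ^ (-solOrder j) : ℝ) : ℂ) * Complex.exp (a * t))) := by
      simp_rw [mul_sub, Finset.sum_sub_distrib]
      have : ∑ j ∈ Finset.range 4,
          solCoeff j * (A * (((a ^ (-solOrder j) : ℝ) : ℂ) * Complex.exp (a * t)))
          = (∑ j ∈ Finset.range 4, solCoeff j * ((a ^ (-solOrder j) : ℝ) : ℂ))
            * (A * Complex.exp (a * t)) := by
        rw [Finset.sum_mul]
        exact Finset.sum_congr rfl fun j _ => by ring
      rw [this, sum_solCoeff_mul_rpow, zero_mul, sub_zero]
      rfl
    rw [e, hK, Finset.sum_mul]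
    refine norm_sum_le_of_le _ fun j hj => ?_
    rw [norm_mul]
    exact (mul_le_mul_of_nonneg_left (key j hj t ht) (norm_nonneg _)).trans_eq (by ring)
  obtain ⟨B, hB⟩ := (isCompact_Icc (a := (0 : ℝ)) (b := 1)).exists_bound_of_continuousOn
    (continuous_solution h).continuousOn
  refine ⟨max B K, fun t ht => ?_⟩
  have hpos : 0 ≤ max B K :=
    ((norm_nonneg _).trans (hB 0 (by simp))).trans (le_max_left _ _)
  rcases le_total t 1 with h1 | h1
  · calc ‖solution v₀ t‖ ≤ B := hB t ⟨ht, h1⟩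
      _ ≤ max B K * 1 := by rw [mul_one]; exact le_max_left _ _
      _ ≤ _ := by gcongr; linarith
  · calc ‖solution v₀ t‖ ≤ K * t := hlarge t h1
      _ ≤ max B K * t := by gcongr; exact le_max_right _ _
      _ ≤ _ := by gcongr; linarith

/-- The equation, solved for its most singular term: a Volterra equation of the second kind with
Abel's kernel. -/
theorem solution_add_fracIntegral {v₀ : ℝ → ℂ} (h : IsRapidlyDecayingSource v₀) :
    ∀ᵐ t, t ∈ Ioi (0 : ℝ) →
      solution v₀ t + ((symbolConst⁻¹ : ℝ) : ℂ) * fracIntegral (1 / 4) (solution v₀) t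
        - ((symbolConst⁻¹ : ℝ) : ℂ) * fracIntegral (1 / 4) (sourceExt v₀) t = 0 := by
  have hv := continuous_solution h
  have hc := h.continuous_sourceExt
  have h4 : (0 : ℝ) < 1 / 4 := by norm_num
  have hFv := continuous_fracIntegral h4 hv
  have hFc := continuous_fracIntegral h4 hc
  have hl : ∀ {g : ℝ → ℂ}, Continuous g → LocallyIntegrableOn g (Ici 0) :=
    fun hg => hg.locallyIntegrable.locallyIntegrableOn _
  set z : ℂ := ((symbolConst⁻¹ : ℝ) : ℂ) with hz
  have hW : Continuous fun t => solution v₀ t + z * fracIntegral (1 / 4) (solution v₀) t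
      - z * fracIntegral (1 / 4) (sourceExt v₀) t := by fun_prop
  refine isOpen_Ioi.ae_eq_zero_of_integral_contDiff_smul_eq_zero
    (hW.locallyIntegrable.locallyIntegrableOn _) fun g hg hgs hgt => ?_
  obtain ⟨b, hb⟩ : ∃ b : ℝ, ∀ t, b ≤ t → g t = 0 := by
    obtain ⟨R, hR⟩ := hgs.isCompact.bddAbove
    refine ⟨R + 1, fun t ht => ?_⟩
    by_contra hne
    have := hR (subset_tsupport g hne)
    linarith
  let ψ : halfLineTest := ⟨fun t => (g t : ℂ), Complex.ofRealCLM.contDiff.comp hg, b,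
    fun t ht => by simp [hb t ht]⟩
  have e1 := HalfLineDistribution.integral_solution_mul h
    ((1 + HalfLineDistribution.abelEnd : HalfLineDistribution.TestOp) ψ)
  rw [← HalfLineDistribution.TestOp.mul_apply, HalfLineDistribution.solveEnd_mul_one_add] at e1
  have e2 : ∀ f : ℝ → ℂ, Continuous f →
      ∫ t in Ioi (0 : ℝ), f t * (HalfLineDistribution.abelEnd ψ).1 t
        = z * ∫ t in Ioi (0 : ℝ), fracIntegral (1 / 4) f t * ψ.1 t := by
    intro f hf
    rw [← HalfLineDistribution.integral_mul_rieszEnd h4 hf, ← integral_const_mul]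
    congr 1
    funext t
    rw [HalfLineDistribution.abelEnd, HalfLineDistribution.TestOp.smul_apply]
    simp only [Submodule.coe_smul, Pi.smul_apply, smul_eq_mul]
    ring
  have e3 : ∫ t in Ioi (0 : ℝ), v₀ t * (HalfLineDistribution.abelEnd ψ).1 t
      = ∫ t in Ioi (0 : ℝ), sourceExt v₀ t * (HalfLineDistribution.abelEnd ψ).1 t :=
    setIntegral_congr_fun measurableSet_Ioi fun t ht => by
      rw [sourceExt_of_nonneg v₀ (mem_Ioi.1 ht).le]
  have e4 : ∫ t in Ioi (0 : ℝ), solution v₀ t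
        * ((1 + HalfLineDistribution.abelEnd : HalfLineDistribution.TestOp) ψ).1 t
      = (∫ t in Ioi (0 : ℝ), solution v₀ t * ψ.1 t)
        + ∫ t in Ioi (0 : ℝ), solution v₀ t * (HalfLineDistribution.abelEnd ψ).1 t := by
    rw [← integral_add (HalfLineDistribution.integrableOn_mul_test (hl hv) _)
      (HalfLineDistribution.integrableOn_mul_test (hl hv) _)]
    congr 1
    funext t
    rw [HalfLineDistribution.TestOp.add_apply, HalfLineDistribution.TestOp.one_apply]
    simp only [Submodule.coe_add, Pi.add_apply]
    ring
  rw [e3, e4, e2 _ hc, e2 _ hv] at e1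
  have e5 : ∫ t, g t • (solution v₀ t + z * fracIntegral (1 / 4) (solution v₀) t
      - z * fracIntegral (1 / 4) (sourceExt v₀) t)
      = ∫ t in Ioi (0 : ℝ), ((solution v₀ t * ψ.1 t
          + z * (fracIntegral (1 / 4) (solution v₀) t * ψ.1 t))
          - z * (fracIntegral (1 / 4) (sourceExt v₀) t * ψ.1 t)) := by
    rw [← setIntegral_eq_integral_of_forall_compl_eq_zero (s := Ioi 0)]
    · congr 1
      funext t
      simp only [Complex.real_smul, ψ]
      ring
    · intro t ht
      have : g t = 0 := by
        by_contra hne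
        exact ht (hgt (subset_tsupport g hne))
      rw [this, zero_smul]
  have i1 := HalfLineDistribution.integrableOn_mul_test (hl hv) ψ
  have i2 := (HalfLineDistribution.integrableOn_mul_test (hl hFv) ψ).const_mul z
  have i3 := (HalfLineDistribution.integrableOn_mul_test (hl hFc) ψ).const_mul z
  have i12 : IntegrableOn (fun t => solution v₀ t * ψ.1 t
      + z * (fracIntegral (1 / 4) (solution v₀) t * ψ.1 t)) (Ioi 0) := i1.add i2
  rw [e5, integral_sub i12 i3, integral_add i1 i2, integral_const_mul, integral_const_mul,
    ← e1, sub_self]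

theorem integrableOn_cexp_mul_solution {v₀ : ℝ → ℂ} (h : IsRapidlyDecayingSource v₀) {p : ℂ}
    (hp : 0 < p.re) :
    IntegrableOn (fun t : ℝ => Complex.exp (-p * t) * solution v₀ t) (Ioi 0) := by
  obtain ⟨C, hC⟩ := exists_linear_growth_solution h
  exact integrableOn_cexp_mul_of_linear_growth (continuous_solution h) hC hp

theorem laplace_solution {v₀ : ℝ → ℂ} (h : IsRapidlyDecayingSource v₀) {p : ℂ}
    (hp : 0 < p.re) : laplace (solution v₀) p
      = laplace v₀ p / (1 + 4 * Complex.Gamma (3 / 4) * p ^ (1 / 4 : ℂ)) := by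
  have h4 : (0 : ℝ) < 1 / 4 := by norm_num
  obtain ⟨M, hM⟩ := h.exists_bound_sourceExt
  have hM0 : 0 ≤ M := (norm_nonneg _).trans (hM 0)
  have iv := integrableOn_cexp_mul_solution h hp
  have ic := integrableOn_cexp_mul_of_linear_growth h.continuous_sourceExt (C := M)
    (fun t ht => (hM t).trans (le_mul_of_one_le_right hM0 (by linarith))) hp
  have iFv := integrableOn_cexp_mul_fracIntegral h4 hp iv
  have iFc := integrableOn_cexp_mul_fracIntegral h4 hp ic
  have lv := laplace_fracIntegral h4 hp iv
  have lc := laplace_fracIntegral h4 hp ic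
  set z : ℂ := ((symbolConst⁻¹ : ℝ) : ℂ) with hz
  have e0 : laplace (sourceExt v₀) p = laplace v₀ p :=
    setIntegral_congr_fun measurableSet_Ioi fun t ht => by
      rw [sourceExt_of_nonneg v₀ (mem_Ioi.1 ht).le]
  have key : laplace (solution v₀) p + z * laplace (fracIntegral (1 / 4) (solution v₀)) p
      - z * laplace (fracIntegral (1 / 4) (sourceExt v₀)) p = 0 := by
    have i12 : IntegrableOn (fun t : ℝ => Complex.exp (-p * t) * solution v₀ t
        + z * (Complex.exp (-p * t) * fracIntegral (1 / 4) (solution v₀) t)) (Ioi 0) :=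
      iv.add (iFv.const_mul z)
    unfold laplace
    rw [← integral_const_mul, ← integral_const_mul, ← integral_add iv (iFv.const_mul z),
      ← integral_sub i12 (iFc.const_mul z)]
    refine integral_eq_zero_of_ae ?_
    filter_upwards [ae_restrict_mem measurableSet_Ioi,
      ae_restrict_of_ae (solution_add_fracIntegral h)] with t ht hE
    have := hE ht
    simp only [Pi.zero_apply]
    linear_combination Complex.exp (-p * t) * this
  have hp0 : p ≠ 0 := fun h0 => by simp [h0] at hp
  set q : ℂ := p ^ (1 / 4 : ℂ) with hq
  have hq0 : q ≠ 0 := by rw [hq, Complex.cpow_ne_zero_iff]; exact Or.inl hp0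
  have hqinv : p ^ (-((1 / 4 : ℝ) : ℂ)) = q⁻¹ := by
    rw [Complex.cpow_neg, hq]; push_cast; rfl
  -- The argument of `p^{1/4}` is below `π/8` in absolute value, so the denominator is not `0`.
  have hqre : 0 < q.re := by
    have harg := Complex.abs_arg_lt_pi_div_two_iff.2 (Or.inl hp)
    have hlog : q = Complex.exp (Complex.log p * (1 / 4)) := Complex.cpow_def_of_ne_zero hp0 _
    rw [hlog, Complex.exp_re]
    refine mul_pos (Real.exp_pos _) (Real.cos_pos_of_mem_Ioo ?_)
    have e : (Complex.log p * (1 / 4)).im = p.arg / 4 := by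
      rw [show (1 / 4 : ℂ) = ((1 / 4 : ℝ) : ℂ) by push_cast; rfl, Complex.im_mul_ofReal,
        Complex.log_im]
      ring
    rw [e]
    have := abs_lt.1 harg
    constructor <;> linarith [Real.pi_pos]
  have hcz : (symbolConst : ℂ) * z = 1 := by
    rw [hz, ← Complex.ofReal_mul, mul_inv_cancel₀ symbolConst_pos.ne', Complex.ofReal_one]
  have hsc : 4 * Complex.Gamma (3 / 4) = (symbolConst : ℂ) := by
    rw [symbolConst, Complex.ofReal_mul, ← Complex.Gamma_ofReal]; push_cast; rfl
  have hden : 1 + (symbolConst : ℂ) * q ≠ 0 := by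
    intro h0
    have := congrArg Complex.re h0
    simp only [Complex.add_re, Complex.one_re, Complex.re_ofReal_mul, Complex.zero_re] at this
    nlinarith [mul_pos symbolConst_pos hqre]
  rw [lv, lc, e0, hqinv] at key
  rw [hsc, eq_div_iff hden]
  have hqq : q⁻¹ * q = 1 := inv_mul_cancel₀ hq0
  set V := laplace (solution v₀) p
  set W := laplace v₀ p
  linear_combination (symbolConst : ℂ) * q * key - (V - W) * (q⁻¹ * q) * hcz - (V - W) * hqq

/-! ### Removal of the test at the end point -/

namespace HalfLineDistribution

/-- Every test function agrees near `0` with test functions supported in `[0, r]`, bounded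
uniformly in `r` and with derivative of order `1 / r`. -/
theorem exists_cutoff (φ : halfLineTest) : ∃ K : ℝ, 0 ≤ K ∧ ∀ r : ℝ, 0 < r → r ≤ 1 →
    ∃ ψ : halfLineTest, (∀ t, r ≤ t → ψ.1 t = 0) ∧ (∀ t ≤ r / 2, ψ.1 t = φ.1 t) ∧
      ∀ t ∈ Icc 0 r, ‖ψ.1 t‖ ≤ K ∧ ‖deriv ψ.1 t‖ ≤ K / r := by
  obtain ⟨M, hM0, hM⟩ := exists_bound φ 1 0 1
  have hst : ContDiff ℝ ∞ Real.smoothTransition := Real.smoothTransition.contDiff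
  obtain ⟨L, hL⟩ := (isCompact_Icc (a := (-1 : ℝ)) (b := 1)).exists_bound_of_continuousOn
    (contDiff_infty_iff_deriv.1 hst).2.continuous.continuousOn
  have hL0 : 0 ≤ L := (norm_nonneg _).trans (hL 0 (by simp))
  -- The cutoff function is `1 - smoothTransition (2t/r - 1)`; its derivative is at most `2L/r`.
  refine ⟨M + 2 * L * M, by positivity, fun r hr hr1 => ?_⟩
  have hχ : ContDiff ℝ ∞ fun t : ℝ => ((1 - Real.smoothTransition (2 / r * t - 1) : ℝ) : ℂ) :=
    Complex.ofRealCLM.contDiff.comp (contDiff_const.sub (hst.comp (by fun_prop)))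
  have hv : ∀ t, r ≤ t → ((1 - Real.smoothTransition (2 / r * t - 1) : ℝ) : ℂ) * φ.1 t = 0 := by
    intro t ht
    rw [Real.smoothTransition.one_of_one_le]
    · simp
    · have : 2 / r * r ≤ 2 / r * t := by gcongr
      rw [div_mul_cancel₀ _ hr.ne'] at this
      linarith
  refine ⟨⟨fun t => ((1 - Real.smoothTransition (2 / r * t - 1) : ℝ) : ℂ) * φ.1 t,
    hχ.mul φ.2.1, r, hv⟩, hv, fun t ht => ?_, fun t ht => ?_⟩
  · have h1 : 2 / r * t ≤ 2 / r * (r / 2) := by gcongr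
    rw [show 2 / r * (r / 2) = 1 by field_simp] at h1
    simp [Real.smoothTransition.zero_of_nonpos (show 2 / r * t - 1 ≤ 0 by linarith)]
  · have hx0 : 0 ≤ 2 / r * t := mul_nonneg (by positivity) ht.1
    have hx2 : 2 / r * t ≤ 2 := by
      have : 2 / r * t ≤ 2 / r * r := by gcongr; exact ht.2
      rwa [div_mul_cancel₀ _ hr.ne'] at this
    have n0 : ‖((1 - Real.smoothTransition (2 / r * t - 1) : ℝ) : ℂ)‖ ≤ 1 := by
      rw [Complex.norm_real, Real.norm_eq_abs, abs_le]
      have h1 := Real.smoothTransition.nonneg (2 / r * t - 1)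
      have h2 := Real.smoothTransition.le_one (2 / r * t - 1)
      constructor <;> linarith
    have hφ0 : ‖φ.1 t‖ ≤ M := by
      simpa using hM 0 (by omega) t ⟨ht.1, ht.2.trans hr1⟩
    have hφ1 : ‖deriv φ.1 t‖ ≤ M := by
      simpa using hM 1 le_rfl t ⟨ht.1, ht.2.trans hr1⟩
    constructor
    · calc _ = ‖((1 - Real.smoothTransition (2 / r * t - 1) : ℝ) : ℂ)‖ * ‖φ.1 t‖ := norm_mul _ _
        _ ≤ 1 * M := by gcongr
        _ ≤ _ := by rw [one_mul]; exact le_add_of_nonneg_right (by positivity)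
    · have d1 : HasDerivAt (fun t : ℝ => ((1 - Real.smoothTransition (2 / r * t - 1) : ℝ) : ℂ))
          ((-(deriv Real.smoothTransition (2 / r * t - 1) * (2 / r)) : ℝ) : ℂ) t := by
        have d0 : HasDerivAt (fun t : ℝ => 2 / r * t - 1) (2 / r) t := by
          simpa using ((hasDerivAt_id t).const_mul (2 / r)).sub_const 1
        have d := ((contDiff_infty_iff_deriv.1 hst).1 (2 / r * t - 1)).hasDerivAt.comp t d0
        exact (d.const_sub 1).ofReal_comp
      have d2 := (contDiff_infty_iff_deriv.1 φ.2.1).1 t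
      have d3 := (d1.mul d2.hasDerivAt).deriv
      have n1 : ‖((-(deriv Real.smoothTransition (2 / r * t - 1) * (2 / r)) : ℝ) : ℂ)‖
          ≤ L * (2 / r) := by
        rw [Complex.norm_real, norm_neg, norm_mul, Real.norm_of_nonneg (by positivity : 0 ≤ 2 / r)]
        gcongr
        exact hL _ ⟨by linarith, by linarith⟩
      refine (congrArg norm d3).trans_le ((norm_add_le _ _).trans ?_)
      rw [norm_mul, norm_mul]
      calc _ ≤ L * (2 / r) * M + 1 * M := by gcongr
        _ ≤ L * (2 / r) * M + M / r := by
          rw [one_mul]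
          gcongr
          exact (le_div_iff₀ hr).2 (mul_le_of_le_one_right hM0 hr1)
        _ = _ := by ring

theorem corrEnd_tPow_apply_eq_zero {ψ : halfLineTest} {r : ℝ} (hr : ∀ t, r ≤ t → ψ.1 t = 0) {s : ℝ}
    (hs : r ≤ s) : (corrEnd tPow ψ).1 s = 0 := by
  rw [corrEnd_apply, tPow_pair_eq, setIntegral_eq_zero_of_forall_eq_zero, mul_zero]
  intro t ht
  have h := iteratedDeriv_vanish ψ r hr 1 (s + t) (by linarith [mem_Ioi.1 ht])
  rw [iteratedDeriv_one] at h
  simp only [translate, deriv_comp_const_add]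
  rw [h, mul_zero]

/-- The bound is `4 D ∫₀^r t^{-1/4} dt`. -/
theorem norm_corrEnd_tPow_apply_le {ψ : halfLineTest} {r D : ℝ} (hr0 : 0 < r) (hD0 : 0 ≤ D)
    (hr : ∀ t, r ≤ t → ψ.1 t = 0) (hD : ∀ t ∈ Icc 0 r, ‖deriv ψ.1 t‖ ≤ D) {s : ℝ}
    (hs : 0 ≤ s) : ‖(corrEnd tPow ψ).1 s‖ ≤ 16 / 3 * D * r ^ (3 / 4 : ℝ) := by
  have hz : ∀ x, r ≤ x → deriv ψ.1 x = 0 := fun x hx => by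
    simpa using iteratedDeriv_vanish ψ r hr 1 x hx
  have hD' : ∀ x, 0 ≤ x → ‖deriv ψ.1 x‖ ≤ D := by
    intro x hx
    rcases le_total x r with h | h
    · exact hD x ⟨hx, h⟩
    · rw [hz x h, norm_zero]; exact hD0
  rw [corrEnd_apply, tPow_pair_eq]
  have e : ∫ t in Ioi (0 : ℝ), ((t ^ (-(1 / 4) : ℝ) : ℝ) : ℂ) * deriv (translate s ψ).1 t
      = ∫ t in (0 : ℝ)..r, ((t ^ (-(1 / 4) : ℝ) : ℝ) : ℂ) * deriv ψ.1 (s + t) := by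
    rw [intervalIntegral.integral_of_le hr0.le]
    simp only [translate, deriv_comp_const_add]
    refine setIntegral_eq_of_subset_of_forall_sdiff_eq_zero measurableSet_Ioi
      Ioc_subset_Ioi_self fun t ht => ?_
    have : r ≤ t := by
      by_contra h
      exact ht.2 ⟨ht.1, (not_le.1 h).le⟩
    rw [hz _ (by linarith), mul_zero]
  have hi : IntervalIntegrable (fun t : ℝ => t ^ (-(1 / 4) : ℝ)) volume 0 r :=
    intervalIntegral.intervalIntegrable_rpow' (by norm_num)
  have hb : ‖∫ t in (0 : ℝ)..r, ((t ^ (-(1 / 4) : ℝ) : ℝ) : ℂ) * deriv ψ.1 (s + t)‖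
      ≤ ∫ t in (0 : ℝ)..r, D * t ^ (-(1 / 4) : ℝ) := by
    refine intervalIntegral.norm_integral_le_of_norm_le hr0.le ?_ (hi.const_mul D)
    refine Eventually.of_forall fun t ht => ?_
    have hp : 0 ≤ t ^ (-(1 / 4) : ℝ) := Real.rpow_nonneg ht.1.le _
    rw [norm_mul, Complex.norm_real, Real.norm_of_nonneg hp, mul_comm]
    gcongr
    exact hD' _ (by linarith [ht.1])
  rw [intervalIntegral.integral_const_mul, integral_rpow (Or.inl (by norm_num)),
    show (-(1 / 4) + 1 : ℝ) = 3 / 4 by norm_num, Real.zero_rpow (by norm_num), sub_zero] at hb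
  rw [e, norm_mul]
  calc _ ≤ ‖(4 : ℂ)‖ * (D * (r ^ (3 / 4 : ℝ) / (3 / 4))) := by gcongr
    _ = _ := by rw [Complex.norm_ofNat]; ring

theorem norm_integral_mul_le {f g : ℝ → ℂ} (hf : LocallyIntegrableOn f (Ici 0)) {r B : ℝ}
    (hg0 : ∀ t, r ≤ t → g t = 0) (hgB : ∀ t ∈ Icc 0 r, ‖g t‖ ≤ B) :
    ‖∫ t in Ioi (0 : ℝ), f t * g t‖ ≤ B * ∫ t in Ioc 0 r, ‖f t‖ := by
  have hi : IntegrableOn (fun t => ‖f t‖) (Ioc 0 r) :=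
    ((hf.integrableOn_compact_subset Icc_subset_Ici_self isCompact_Icc).mono_set
      Ioc_subset_Icc_self).norm
  have e : ∫ t in Ioi (0 : ℝ), f t * g t = ∫ t in Ioc 0 r, f t * g t := by
    refine setIntegral_eq_of_subset_of_forall_sdiff_eq_zero measurableSet_Ioi
      Ioc_subset_Ioi_self fun t ht => ?_
    have : r ≤ t := by
      by_contra h
      exact ht.2 ⟨ht.1, (not_le.1 h).le⟩
    rw [hg0 _ this, mul_zero]
  rw [e, ← integral_const_mul]
  refine norm_integral_le_of_norm_le (hi.const_mul B) ?_
  filter_upwards [ae_restrict_mem measurableSet_Ioc] with t ht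
  rw [norm_mul, mul_comm]
  gcongr
  exact hgB t (Ioc_subset_Icc_self ht)

theorem setIntegral_norm_le_of_le_rpow {f : ℝ → ℂ} {δ r : ℝ} (hr : 0 < r)
    (hf : ∀ t ∈ Ioc 0 r, ‖f t‖ ≤ δ * t ^ (-(3 / 4) : ℝ)) :
    ∫ t in Ioc 0 r, ‖f t‖ ≤ 4 * δ * r ^ (1 / 4 : ℝ) := by
  have hi : IntervalIntegrable (fun t : ℝ => δ * t ^ (-(3 / 4) : ℝ)) volume 0 r :=
    (intervalIntegral.intervalIntegrable_rpow' (by norm_num)).const_mul δ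
  have hI : ∫ t in (0 : ℝ)..r, δ * t ^ (-(3 / 4) : ℝ) = 4 * δ * r ^ (1 / 4 : ℝ) := by
    rw [intervalIntegral.integral_const_mul, integral_rpow (Or.inl (by norm_num)),
      show (-(3 / 4) + 1 : ℝ) = 1 / 4 by norm_num, Real.zero_rpow (by norm_num), sub_zero]
    ring
  rw [← hI, intervalIntegral.integral_of_le hr.le]
  refine integral_mono_of_nonneg (Eventually.of_forall fun _ => norm_nonneg _)
    ((intervalIntegrable_iff_integrableOn_Ioc_of_le hr.le).1 hi) ?_
  filter_upwards [ae_restrict_mem measurableSet_Ioc] with t ht using hf t ht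

/-- For a function that is `o(t^{-3/4})` at `0`, the equation tested in `(0, ∞)` implies the
equation tested in `[0, ∞)`: testing against a cutoff of width `r`, the operator
`corrEnd tPow` contributes a factor `r^{-1/4}`, against an integral `o(r^{1/4})`. -/
theorem IsSolutionOnIoi.isSolution {v₀ : ℝ → ℂ} (hv₀ : IsRapidlyDecayingSource v₀)
    {w : HalfLineDistribution} {f : ℝ → ℂ} (hw : w.IsSolutionOnIoi v₀) (hf : w.IsFun f)
    (ho : f =o[𝓝[>] 0] (fun t : ℝ => t ^ (-(3 / 4) : ℝ))) : w.IsSolution v₀ := by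
  intro φ
  obtain ⟨M, hM⟩ := hv₀.exists_bound_sourceExt
  have hM0 : 0 ≤ M := (norm_nonneg _).trans (hM 0)
  have hl₀ : LocallyIntegrableOn v₀ (Ici 0) :=
    hv₀.smooth.continuousOn.locallyIntegrableOn measurableSet_Ici
  obtain ⟨K, hK0, hK⟩ := exists_cutoff φ
  have hconv : ∀ ψ, (conv tPow w).pair ψ = w.pair (corrEnd tPow ψ) := fun _ => rfl
  -- The defect of the equation; it vanishes on test functions that are `0` near `0`, so that its
  -- value at `φ` is its value at any cutoff of `φ`.
  set d : halfLineTest → ℂ := fun ψ =>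
    w.pair ψ - (∫ t in Ioi (0 : ℝ), v₀ t * ψ.1 t) - w.pair (corrEnd tPow ψ) with hd
  have hdsub : ∀ ψ χ, d (ψ - χ) = d ψ - d χ := by
    intro ψ χ
    have h1 : corrEnd tPow (ψ - χ) = corrEnd tPow ψ - corrEnd tPow χ :=
      LinearMap.map_sub (show halfLineTest →ₗ[ℂ] halfLineTest from corrEnd tPow) ψ χ
    have h2 := (ofFun v₀ hl₀).pair.map_sub ψ χ
    rw [ofFun_pair, ofFun_pair, ofFun_pair] at h2
    simp only [hd]
    rw [h1, map_sub, map_sub, h2]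
    ring
  have key : ∀ δ : ℝ, 0 < δ → ‖d φ‖ ≤ (4 * K + 2 * K * M + 64 / 3 * K) * δ := by
    intro δ hδ
    obtain ⟨r₁, hr₁, hfr⟩ := mem_nhdsGT_iff_exists_Ioc_subset.1 (ho.bound hδ)
    set r := min (min r₁ 1) δ with hr
    have hr0 : 0 < r := lt_min (lt_min hr₁ one_pos) hδ
    have hr1 : r ≤ 1 := (min_le_left _ _).trans (min_le_right _ _)
    have hrr : r ≤ r₁ := (min_le_left _ _).trans (min_le_left _ _)
    have hrδ : r ≤ δ := min_le_right _ _
    obtain ⟨ψ, hψ0, hψφ, hψb⟩ := hK r hr0 hr1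
    have e : d φ = d ψ := by
      have h0 := hw (φ - ψ) ⟨r / 2, by positivity, fun t ht => by
        change φ.1 t - ψ.1 t = 0
        rw [hψφ t ht, sub_self]⟩
      have h1 : d (φ - ψ) = 0 := by
        simp only [hd]
        rw [h0, hconv]; ring
      rw [hdsub] at h1
      exact sub_eq_zero.1 h1
    have hI : ∫ t in Ioc 0 r, ‖f t‖ ≤ 4 * δ * r ^ (1 / 4 : ℝ) := by
      refine setIntegral_norm_le_of_le_rpow hr0 fun t ht => ?_
      have := hfr ⟨ht.1, ht.2.trans hrr⟩
      rwa [mem_ofPred_eq, Real.norm_of_nonneg (Real.rpow_nonneg ht.1.le _)] at this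
    have hrp : r ^ (1 / 4 : ℝ) ≤ 1 := Real.rpow_le_one hr0.le hr1 (by norm_num)
    have b1 : ‖w.pair ψ‖ ≤ 4 * K * δ := by
      rw [hf.2]
      calc _ ≤ K * ∫ t in Ioc 0 r, ‖f t‖ :=
            norm_integral_mul_le hf.1 hψ0 fun t ht => (hψb t ht).1
        _ ≤ K * (4 * δ * 1) := by gcongr; exact hI.trans (by gcongr)
        _ = _ := by ring
    have b2 : ‖∫ t in Ioi (0 : ℝ), v₀ t * ψ.1 t‖ ≤ 2 * K * M * δ := by
      have hv : ∫ t in Ioc 0 r, ‖v₀ t‖ ≤ M * r := by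
        have := norm_setIntegral_le_of_norm_le_const (μ := volume) (s := Ioc 0 r)
          (f := fun t => ‖v₀ t‖) (C := M) (by simp) (fun t ht => by
            rw [norm_norm, ← sourceExt_of_nonneg v₀ ht.1.le]; exact hM t)
        rw [Real.volume_real_Ioc_of_le hr0.le, sub_zero] at this
        exact (le_abs_self _).trans this
      calc _ ≤ K * ∫ t in Ioc 0 r, ‖v₀ t‖ :=
            norm_integral_mul_le hl₀ hψ0 fun t ht => (hψb t ht).1
        _ ≤ K * (M * δ) := by gcongr; exact hv.trans (by gcongr)
        _ ≤ _ := by nlinarith [mul_nonneg (mul_nonneg hK0 hM0) hδ.le]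
    have b3 : ‖w.pair (corrEnd tPow ψ)‖ ≤ 64 / 3 * K * δ := by
      rw [hf.2]
      calc _ ≤ 16 / 3 * (K / r) * r ^ (3 / 4 : ℝ) * ∫ t in Ioc 0 r, ‖f t‖ :=
            norm_integral_mul_le hf.1 (fun t ht => corrEnd_tPow_apply_eq_zero hψ0 ht)
              fun t ht => norm_corrEnd_tPow_apply_le hr0 (by positivity) hψ0
                (fun t ht => (hψb t ht).2) ht.1
        _ ≤ 16 / 3 * (K / r) * r ^ (3 / 4 : ℝ) * (4 * δ * r ^ (1 / 4 : ℝ)) := by gcongr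
        _ = 64 / 3 * K * δ * ((r ^ (3 / 4 : ℝ) * r ^ (1 / 4 : ℝ)) / r) := by ring
        _ = _ := by
          rw [← Real.rpow_add hr0, show (3 / 4 + 1 / 4 : ℝ) = 1 by norm_num, Real.rpow_one,
            div_self hr0.ne', mul_one]
    rw [e]
    calc ‖d ψ‖ ≤ ‖w.pair ψ‖ + ‖∫ t in Ioi (0 : ℝ), v₀ t * ψ.1 t‖
          + ‖w.pair (corrEnd tPow ψ)‖ := (norm_sub_le _ _).trans (by gcongr; exact norm_sub_le _ _)
      _ ≤ 4 * K * δ + 2 * K * M * δ + 64 / 3 * K * δ := by gcongr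
      _ = _ := by ring
  have hlim : Tendsto (fun δ : ℝ => (4 * K + 2 * K * M + 64 / 3 * K) * δ) (𝓝[>] 0) (𝓝 0) := by
    have : Tendsto (fun δ : ℝ => (4 * K + 2 * K * M + 64 / 3 * K) * δ) (𝓝 0) (𝓝 0) :=
      (by fun_prop : Continuous fun δ : ℝ => (4 * K + 2 * K * M + 64 / 3 * K) * δ).tendsto' _ _
        (by simp)
    exact this.mono_left nhdsWithin_le_nhds
  have h0 : ‖d φ‖ ≤ 0 := by
    refine ge_of_tendsto hlim ?_
    filter_upwards [self_mem_nhdsWithin] with δ hδ using key δ hδ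
  have h1 : d φ = 0 := norm_le_zero_iff.1 h0
  simp only [hd] at h1
  rw [hconv]
  linear_combination h1

end HalfLineDistribution

/-! ### Behaviour at the end point and the main result -/

theorem solution_isLittleO {v₀ : ℝ → ℂ} (h : IsRapidlyDecayingSource v₀) :
    solution v₀ =o[𝓝[>] 0] (fun t : ℝ => t ^ (-(5 / 4) : ℝ)) := by
  have h1 : solution v₀ =O[𝓝[>] 0] (fun _ : ℝ => (1 : ℝ)) :=
    (((continuous_solution h).tendsto 0).mono_left nhdsWithin_le_nhds).isBigO_one ℝ
  refine h1.trans_isLittleO ((Asymptotics.isLittleO_const_left_of_ne one_ne_zero).2 ?_)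
  exact tendsto_norm_atTop_atTop.comp (tendsto_rpow_neg_nhdsGT_zero (by norm_num))

theorem tendsto_solution_div {v₀ : ℝ → ℂ} (h : IsRapidlyDecayingSource v₀) :
    Tendsto (fun t : ℝ => solution v₀ t / ((t ^ (1 / 4 : ℝ) : ℝ) : ℂ)) (𝓝[>] 0)
      (𝓝 (v₀ 0 / (4 * Complex.Gamma (3 / 4) * Complex.Gamma (5 / 4)))) := by
  set g := expConv growthRate (sourceExt v₀) with hg
  have hgc : Continuous g := continuous_expConv _ h.continuous_sourceExt
  have hterm : ∀ j : ℕ, Tendsto (fun t : ℝ => solCoeff j * (fracIntegral (solOrder j) g t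
      / ((t ^ (1 / 4 : ℝ) : ℝ) : ℂ))) (𝓝[>] 0)
      (𝓝 (if j = 0 then solCoeff 0 * (g 0 / Complex.Gamma (5 / 4)) else 0)) := by
    intro j
    have h1 := tendsto_fracIntegral_div (solOrder_pos j) hgc
    split_ifs with hj
    · subst hj
      have e : solOrder 0 = 1 / 4 := by norm_num [solOrder]
      rw [e] at h1 ⊢
      have e2 : (((1 / 4 : ℝ) : ℂ) + 1) = 5 / 4 := by push_cast; norm_num
      rw [e2] at h1
      exact h1.const_mul _
    · have hpos : 0 < solOrder j - 1 / 4 := by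
        have : (1 : ℝ) ≤ j := by exact_mod_cast Nat.one_le_iff_ne_zero.2 hj
        unfold solOrder; push_cast; linarith
      have h2 : Tendsto (fun t : ℝ => ((t ^ (solOrder j - 1 / 4) : ℝ) : ℂ)) (𝓝[>] 0) (𝓝 0) := by
        have : Continuous fun t : ℝ => ((t ^ (solOrder j - 1 / 4) : ℝ) : ℂ) :=
          Complex.continuous_ofReal.comp (Real.continuous_rpow_const hpos.le)
        exact (this.tendsto' 0 0 (by rw [Real.zero_rpow hpos.ne', Complex.ofReal_zero])).mono_left
          nhdsWithin_le_nhds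
      have h3 := (h2.mul h1).const_mul (solCoeff j)
      rw [zero_mul, mul_zero] at h3
      refine h3.congr' ?_
      filter_upwards [self_mem_nhdsWithin] with t ht
      have ht : (0 : ℝ) < t := ht
      have n1 : ((t ^ solOrder j : ℝ) : ℂ) ≠ 0 :=
        Complex.ofReal_ne_zero.2 (Real.rpow_pos_of_pos ht _).ne'
      have n2 : ((t ^ (1 / 4 : ℝ) : ℝ) : ℂ) ≠ 0 :=
        Complex.ofReal_ne_zero.2 (Real.rpow_pos_of_pos ht _).ne'
      rw [Real.rpow_sub ht, Complex.ofReal_div]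
      field_simp
  have hsum := tendsto_finsetSum (Finset.range 4) fun j _ => hterm j
  rw [Finset.sum_ite_eq' (Finset.range 4) 0, if_pos (by simp)] at hsum
  have e0 : solCoeff 0 * (g 0 / Complex.Gamma (5 / 4))
      = v₀ 0 / (4 * Complex.Gamma (3 / 4) * Complex.Gamma (5 / 4)) := by
    have hsc : 4 * Complex.Gamma (3 / 4) = (symbolConst : ℂ) := by
      rw [symbolConst, Complex.ofReal_mul, ← Complex.Gamma_ofReal]; push_cast; rfl
    rw [hsc, hg, expConv_zero, sourceExt_of_nonneg _ le_rfl, solCoeff]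
    simp only [pow_zero, zero_add, pow_one, one_mul, Complex.ofReal_inv]
    rw [inv_mul_eq_div, div_div, mul_comm (Complex.Gamma _)]
  rw [e0] at hsum
  refine hsum.congr fun t => ?_
  rw [solution, Finset.sum_div]
  exact Finset.sum_congr rfl fun j _ => by rw [mul_div_assoc]

theorem theorem1 (v₀ : ℝ → ℂ) (hv₀ : IsRapidlyDecayingSource v₀) :
    ∃ (u : HalfLineDistribution) (v : ℝ → ℂ),
      -- existence and uniqueness, among all distributions on the closed half-line
      u.IsSolution v₀ ∧
      (∀ w : HalfLineDistribution, w.IsSolution v₀ → w = u) ∧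
      -- the solution is a continuous function vanishing for negative `t`
      u.IsFun v ∧ Continuous v ∧ (∀ t < 0, v t = 0) ∧
      -- with test functions from `C₀^∞((0, ∞))` only, uniqueness among functions `o(t^{-3/4})`
      (∀ (w : HalfLineDistribution) (f : ℝ → ℂ), w.IsSolutionOnIoi v₀ → w.IsFun f →
        f =o[𝓝[>] 0] (fun t : ℝ => t ^ (-(3 / 4) : ℝ)) → w = u) ∧
      -- the solution is less singular than `t^{-5/4}` as `t → 0`
      v =o[𝓝[>] 0] (fun t : ℝ => t ^ (-(5 / 4) : ℝ)) ∧
      -- the Laplace transform of the solution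
      (∀ p : ℂ, 0 < p.re →
        IntegrableOn (fun t : ℝ => Complex.exp (-p * t) * v t) (Ioi 0) ∧
        laplace v p = laplace v₀ p / (1 + 4 * Complex.Gamma (3 / 4) * p ^ (1 / 4 : ℂ))) ∧
      -- the leading term of the solution as `t → 0`
      Tendsto (fun t : ℝ => v t / ((t ^ (1 / 4 : ℝ) : ℝ) : ℂ)) (𝓝[>] 0)
        (𝓝 (v₀ 0 / (4 * Complex.Gamma (3 / 4) * Complex.Gamma (5 / 4)))) := by
  have hc := continuous_solution hv₀
  have hl : LocallyIntegrableOn (solution v₀) (Ici 0) :=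
    hc.locallyIntegrable.locallyIntegrableOn _
  have hpair : ∀ ψ, (HalfLineDistribution.ofFun (solution v₀) hl).pair ψ
      = ∫ t in Ioi (0 : ℝ), v₀ t * (HalfLineDistribution.solveEnd ψ).1 t := fun ψ =>
    (HalfLineDistribution.integral_solution_mul hv₀ ψ).symm
  have huniq : ∀ w : HalfLineDistribution, w.IsSolution v₀ →
      w = HalfLineDistribution.ofFun (solution v₀) hl := fun w hw =>
    HalfLineDistribution.ext (LinearMap.ext fun ψ =>
      ((HalfLineDistribution.isSolution_iff_pair_eq v₀ w).1 hw ψ).trans (hpair ψ).symm)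
  exact ⟨HalfLineDistribution.ofFun (solution v₀) hl, solution v₀,
    (HalfLineDistribution.isSolution_iff_pair_eq v₀ _).2 hpair, huniq,
    ⟨hl, fun _ => rfl⟩, hc, fun t ht => solution_of_nonpos v₀ ht.le,
    fun w f hw hf ho => huniq w (hw.isSolution hv₀ hf ho), solution_isLittleO hv₀,
    fun p hp => ⟨integrableOn_cexp_mul_solution hv₀ hp, laplace_solution hv₀ hp⟩,
    tendsto_solution_div hv₀⟩
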